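/- Let $\Sigma$ be a finite alphabet and $n,k\in\mathbb N$. A $(k,n,\Sigma)$ block decision tree is a rooted tree $T$ of height $k$ in which every node $v$ at depth $<k$ has exactly $|\Sigma|$ children, labeled with the symbols of $\Sigma$, and has an associated function $v:\{0,1\}^n\to\Sigma$. On input $X_1,\dots,X_k\in\{0,1\}^n$ it starts at the root and, at a node $v$ of depth $i-1$, moves to the child of $v$ labeled $v(X_i)$; let $T(X_1,\dots,X_k)$ be the leaf that it reaches. Write $U_m$ for the uniform distribution on $\{0,1\}^m$. A function $\mathsf{Gen}:\{0,1\}^s\to\{0,1\}^{nk}$ is a $\gamma$-PRG for $(k,n,\Sigma)$ block decision trees if for every such tree $T$ the distributions $T(\mathsf{Gen}(U_s))$ and $T(U_{nk})$ have total variation distance at most $\gamma$. **Theorem.** There are absolute constants $C$ and $c$ and a (deterministic) Turing machine $M$ such that for all $n,k\in\mathbb N$, every finite alphabet $\Sigma$ and every real $\gamma>0$ there exists a $\gamma$-PRG $\mathsf{Gen}:\{0,1\}^s\to\{0,1\}^{nk}$ for $(k,n,\Sigma)$ block decision trees with seed length $$s\le n+C\cdot\bigl(k\log_2|\Sigma|+(\log_2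 k)\cdot\max\{0,\log_2(1/\gamma)\}\bigr)$$ that is computed by $M$ in time $\mathrm{poly}(n,k,\log|\Sigma|,\log(1/\gamma))$: with $\ell=\max\{0,\lceil\log_2(1/\gamma)\rceil\}$, for every $x\in\{0,1\}^s$ the machine $M$, given $n$, $k$ and $\ell$ in unary, $|\Sigma|$ in binary, and $x$, outputs $\mathsf{Gen}(x)$ after at most $c\,(n+k+\lceil\log_2|\Sigma|\rceil+\ell+1)^c$ steps. (Here $\log_2 0$ is read as $0$.) -/

import Mathlib

universe u v

/-- The set `{0,1}^n`. -/
abbrev BitString (n : ℕ) : Type := Fin n → Bool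

/-- A `(k, n, A)` block decision tree: a rooted tree of height `k` in which every node at depth
`< k` carries a function `{0,1}^n → A` and has one child for every symbol of `A`. -/
inductive BlockDecisionTree (n : ℕ) (A : Type u) : ℕ → Type u
  | leaf : BlockDecisionTree n A 0
  | node {k : ℕ} (f : BitString n → A) (child : A → BlockDecisionTree n A k) :
      BlockDecisionTree n A (k + 1)

/-- The node that the tree reaches on reading the blocks `X₁, X₂, …`. A node is named by the
sequence of labels on the path from the root to it, so the root is `[]`, and the leaves are the
sequences of length `k`. -/
def BlockDecisionTree.eval {n : ℕ} {A : Type u} :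
    {k : ℕ} → BlockDecisionTree n A k → List (BitString n) → List A
  | _, .leaf, _ => []
  | _, .node _ _, [] => []
  | _, .node f child, X :: Xs => f X :: (child (f X)).eval Xs

/-- Two discrete distributions have total variation distance at most `γ`:
their probabilities of any event differ by at most `γ`. -/
def TVClose {V : Type v} (γ : ℝ) (p q : PMF V) : Prop :=
  ∀ E : Set V, |(p.toOuterMeasure E).toReal - (q.toOuterMeasure E).toReal| ≤ γ

/-- `Gen : {0,1}^s → {0,1}^{nk}` is a `γ`-PRG for `(k, n, A)` block decision trees. The elements of
`{0,1}^{nk}` are given as sequences of `k` blocks of `n` bits. -/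
def IsBlockDecisionTreePRG {s n k : ℕ} (A : Type u) (γ : ℝ)
    (Gen : BitString s → Fin k → BitString n) : Prop :=
  ∀ T : BlockDecisionTree n A k,
    TVClose γ
      ((PMF.uniformOfFintype (BitString s)).map fun x => T.eval (List.ofFn (Gen x)))
      ((PMF.uniformOfFintype (Fin k → BitString n)).map fun X => T.eval (List.ofFn X))

/-- The word `1^n # 1^k # ⟨q⟩ # 1^ℓ # x` over the alphabet `{0, 1, #}`, where `⟨q⟩` is the binary
expansion of `q` and the symbol `#` is `none`. -/
def encodeInput (n k q ℓ : ℕ) {s : ℕ} (x : BitString s) : List (Option Bool) :=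
  List.replicate n (some true) ++ none ::
    (List.replicate k (some true) ++ none ::
      (q.bits.map some ++ none ::
        (List.replicate ℓ (some true) ++ none ::
          (List.ofFn x).map some)))

/-- The concatenation of `k` blocks of `n` bits, as a word over `{0, 1}`. -/
def encodeOutput {n k : ℕ} (X : Fin k → BitString n) : List Bool :=
  (List.ofFn fun i => List.ofFn (X i)).flatten

/-- On the input word `w`, the Turing machine `M` halts after at most `t` steps with output `w'`. -/
def OutputsWithin {Γ₀ Γ₁ : Type} (M : Turing.TM2ComputableAux Γ₀ Γ₁) (w : List Γ₀) (w' : List Γ₁)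
    (t : ℕ) : Prop :=
  Nonempty (Turing.TM2OutputsInTime M.tm (w.map M.inputAlphabet.invFun)
    (some (w'.map M.outputAlphabet.invFun)) t)

/-! The generator is the one of Impagliazzo, Nisan and Wigderson. To double the number of blocks,
the seed `x` of the shorter generator produces the first half, and the endpoint of a random walk
from `x` on an expander of constant degree produces the second half; a walk of `t` steps costs only
`4 * t` further seed bits. A tree whose halves have height `2 ^ i` is in one of `|A| ^ 2 ^ i` states
at the middle. For each state the expander mixing property (`mixing`) makes the two halves nearly
independent, so the errors satisfy `e (i + 1) ≥ 2 * e i + |A| ^ 2 ^ i * (23 / 24) ^ t i`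
(`generator_error`). With `h = k - 1`, `p` the bit length of `|A|` and `2 ^ (-l) ≤ γ`, walks of `34
* (h / 2 ^ i + p * 2 ^ i + l)` steps suffice (`level_error`). Over the levels the first two terms
form geometric sums of order `k` and `k * p`, and only `l` is paid once for each of the roughly `log
k` levels (`seedLength_le`).

The expander lives on bit strings of any length at least two. One step overwrites the first pair of
bits at random and applies one of four linear shears, with the pairs regarded as elements of the
field with four elements. On Walsh coefficients the overwriting kills every frequency with nonzero
first pair, and a shear permutes the frequencies. For a surviving nonzero frequency, two of the four
dual shears remove one leading zero pair and at most one of them adds one (`weightSum_le`). A Schur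
test with weight `3 / 2` per leading zero pair then bounds the operator norm by `23 / 24`
(`avg_hat_smooth_le`).

The machine keeps on a control stack the seed and a straight-line program with one bit per level,
the path to the current block in the recursion. Each run emits one block, and rewinding the stack
increments the path as a binary counter (`reach_rewind_tape`). The walk lengths are computed in
unary, by halving, doubling or keeping marks from one level to the next (`reach_levels`). -/

namespace INW

/-! ### Averages over bit lists -/

/-- The average of `f` over all bit lists of length `m`. -/
noncomputable def avg : ℕ → (List Bool → ℝ) → ℝ
  | 0, f => f []
  | m + 1, f => (avg m (fun l => f (false :: l)) + avg m (fun l => f (true :: l))) / 2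

@[simp] theorem avg_zero (f : List Bool → ℝ) : avg 0 f = f [] := rfl

theorem avg_succ (m : ℕ) (f : List Bool → ℝ) :
    avg (m + 1) f = (avg m (fun l => f (false :: l)) + avg m (fun l => f (true :: l))) / 2 := rfl

theorem avg_congr {m : ℕ} {f g : List Bool → ℝ} (h : ∀ l, l.length = m → f l = g l) :
    avg m f = avg m g := by
  induction m generalizing f g with
  | zero => exact h [] rfl
  | succ m ih =>
    rw [avg_succ, avg_succ, ih (fun l hl => h (false :: l) (by simp [hl])),
      ih (fun l hl => h (true :: l) (by simp [hl]))]

theorem avg_mono {m : ℕ} {f g : List Bool → ℝ} (h : ∀ l, l.length = m → f l ≤ g l) :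
    avg m f ≤ avg m g := by
  induction m generalizing f g with
  | zero => exact h [] rfl
  | succ m ih =>
    have h1 := ih (fun l hl => h (false :: l) (by simp [hl]))
    have h2 := ih (fun l hl => h (true :: l) (by simp [hl]))
    rw [avg_succ, avg_succ]
    linarith

theorem avg_add (m : ℕ) (f g : List Bool → ℝ) :
    avg m (fun l => f l + g l) = avg m f + avg m g := by
  induction m generalizing f g with
  | zero => rfl
  | succ m ih => simp only [avg_succ, ih]; ring

theorem avg_mul_left (m : ℕ) (c : ℝ) (f : List Bool → ℝ) :
    avg m (fun l => c * f l) = c * avg m f := by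
  induction m generalizing f with
  | zero => rfl
  | succ m ih => simp only [avg_succ, ih]; ring

theorem avg_sub (m : ℕ) (f g : List Bool → ℝ) :
    avg m (fun l => f l - g l) = avg m f - avg m g := by
  induction m generalizing f g with
  | zero => rfl
  | succ m ih => simp only [avg_succ, ih]; ring

@[simp] theorem avg_const (m : ℕ) (c : ℝ) : avg m (fun _ => c) = c := by
  induction m with
  | zero => rfl
  | succ m ih => simp only [avg_succ, ih]; ring

theorem avg_nonneg {m : ℕ} {f : List Bool → ℝ} (h : ∀ l, l.length = m → 0 ≤ f l) :
    0 ≤ avg m f := by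
  simpa using avg_mono (f := fun _ => 0) h

theorem avg_sum {ι : Type*} (m : ℕ) (s : Finset ι) (f : ι → List Bool → ℝ) :
    avg m (fun l => ∑ i ∈ s, f i l) = ∑ i ∈ s, avg m (f i) := by
  induction m generalizing f with
  | zero => rfl
  | succ m ih => simp only [avg_succ, ih]; rw [← Finset.sum_add_distrib, Finset.sum_div]

theorem avg_comm (m m' : ℕ) (f : List Bool → List Bool → ℝ) :
    avg m (fun x => avg m' (fun y => f x y)) = avg m' (fun y => avg m (fun x => f x y)) := by
  induction m generalizing f with
  | zero => rfl
  | succ m ih =>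
    simp only [avg_succ, ih]
    rw [← avg_add, div_eq_inv_mul, ← avg_mul_left]
    congr 1; ext; ring

theorem abs_avg_le (m : ℕ) (f : List Bool → ℝ) : |avg m f| ≤ avg m (fun l => |f l|) := by
  induction m generalizing f with
  | zero => exact le_rfl
  | succ m ih =>
    have h1 := ih (fun l => f (false :: l))
    have h2 := ih (fun l => f (true :: l))
    rw [avg_succ, avg_succ, abs_div, abs_two]
    have := abs_add_le (avg m (fun l => f (false :: l))) (avg m (fun l => f (true :: l)))
    gcongr; linarith

theorem avg_append (m m' : ℕ) (f : List Bool → ℝ) :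
    avg (m + m') f = avg m (fun x => avg m' (fun y => f (x ++ y))) := by
  induction m generalizing f with
  | zero => simp
  | succ m ih => rw [Nat.add_right_comm, avg_succ, avg_succ, ih, ih]; rfl

theorem avg_snoc (m : ℕ) (f : List Bool → ℝ) :
    avg (m + 1) f = (avg m (fun l => f (l ++ [false])) + avg m (fun l => f (l ++ [true]))) / 2 := by
  rw [avg_append, div_eq_inv_mul, ← avg_add, ← avg_mul_left]
  congr 1; ext l; rw [avg_succ]; simp only [avg_zero]; ring

theorem avg_two (m : ℕ) (f : List Bool → ℝ) :
    avg (m + 2) f = (avg m (fun l => f (false :: false :: l)) + avg m (fun l => f (false :: true :: l))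
      + avg m (fun l => f (true :: false :: l)) + avg m (fun l => f (true :: true :: l))) / 4 := by
  simp only [avg_succ]; ring

/-- Averages over lists are preserved when the first two bits are shifted by a function of the
rest. -/
theorem avg_two_shift (m : ℕ) (f : List Bool → ℝ) (s t : List Bool → Bool) (φ : List Bool → List Bool) :
    avg (m + 2) (fun l => match l with
      | a :: b :: r => f ((a ^^ s r) :: (b ^^ t r) :: φ r)
      | l => f l) =
    (avg m (fun l => f (false :: false :: φ l)) + avg m (fun l => f (false :: true :: φ l))
      + avg m (fun l => f (true :: false :: φ l)) + avg m (fun l => f (true :: true :: φ l))) / 4 := by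
  rw [avg_two]
  simp only [← avg_add]
  congr 2; ext r
  cases s r <;> cases t r <;> simp <;> ring

/-! ### Walsh characters -/

/-- The Walsh character of frequency `ξ`. -/
noncomputable def walsh : List Bool → List Bool → ℝ
  | a :: ξ, b :: x => (if a && b then -1 else 1) * walsh ξ x
  | _, _ => 1

/-- The Walsh coefficients of `f`. -/
noncomputable def hat (m : ℕ) (f : List Bool → ℝ) (ξ : List Bool) : ℝ :=
  avg m (fun x => f x * walsh ξ x)

/-- Splitting off the first bit turns the coefficients into half the sum and half the difference of
those of the two restrictions. The frequency side is also an average rather than a sum, whence the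
factor `2 ^ m`. -/
theorem parseval (m : ℕ) (f : List Bool → ℝ) :
    avg m (fun x => f x ^ 2) = 2 ^ m * avg m (fun ξ => hat m f ξ ^ 2) := by
  induction m generalizing f with
  | zero => simp [hat, walsh]
  | succ m ih =>
    have e0 : ∀ ξ, hat (m + 1) f (false :: ξ) =
        (hat m (fun l => f (false :: l)) ξ + hat m (fun l => f (true :: l)) ξ) / 2 := by
      intro ξ; simp [hat, avg_succ, walsh]
    have e1 : ∀ ξ, hat (m + 1) f (true :: ξ) =
        (hat m (fun l => f (false :: l)) ξ - hat m (fun l => f (true :: l)) ξ) / 2 := by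
      intro ξ
      have : (fun l => f (true :: l) * walsh (true :: ξ) (true :: l)) =
          fun l => (-1 : ℝ) * (f (true :: l) * walsh ξ l) := by
        ext l; simp [walsh]
      simp only [hat, avg_succ]
      rw [this, avg_mul_left]
      simp only [walsh, Bool.and_false, Bool.false_eq_true, if_false, one_mul]
      ring
    rw [avg_succ, avg_succ, ih (fun l => f (false :: l)), ih (fun l => f (true :: l))]
    simp only [e0, e1]
    rw [← mul_add, ← avg_add, ← avg_add, pow_succ]
    have : (fun l => ((hat m (fun l => f (false :: l)) l + hat m (fun l => f (true :: l)) l) / 2) ^ 2 +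
        ((hat m (fun l => f (false :: l)) l - hat m (fun l => f (true :: l)) l) / 2) ^ 2) =
        fun l => (1 / 2 : ℝ) * (hat m (fun l => f (false :: l)) l ^ 2 + hat m (fun l => f (true :: l)) l ^ 2) := by
      ext; ring
    rw [this, avg_mul_left]; ring

/-! ### The expander step -/

/-- Multiplication by `1` or by a primitive element on pairs of bits, seen as the field with four
elements. -/
def mulF (c : Bool) (w : Bool × Bool) : Bool × Bool :=
  bif c then (w.2, w.1 ^^ w.2) else w

/-- The shear that adds, to every pair of bits at an active position, a multiple of the pair
before it; `w` is the pair before the list. -/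
def shear (c : Bool) : Bool → Bool × Bool → List Bool → List Bool
  | _, _, [] => []
  | π, w, [a] => [a ^^ (π && (mulF c w).1)]
  | π, w, a :: b :: r =>
    (a ^^ (π && (mulF c w).1)) :: (b ^^ (π && (mulF c w).2)) :: shear c (!π) (a, b) r

/-- The first pair of bits of a list, padded by zeros. -/
def headPair : List Bool → Bool × Bool
  | [] => (false, false)
  | [a] => (a, false)
  | a :: b :: _ => (a, b)

/-- The action of `shear` on frequencies. -/
def dualShear (c : Bool) : Bool → List Bool → List Bool
  | _, [] => []
  | _, [a] => [a]
  | π, a :: b :: r =>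
    (a ^^ (!π && (mulF c (headPair r)).1)) :: (b ^^ (!π && (mulF c (headPair r)).2)) ::
      dualShear c (!π) r

theorem shear_length (c π : Bool) (w : Bool × Bool) (l : List Bool) :
    (shear c π w l).length = l.length := by
  fun_induction shear c π w l <;> simp_all

theorem two_step {P : ℕ → Prop} (h0 : P 0) (h1 : P 1) (h : ∀ m, P m → P (m + 2)) (m : ℕ) : P m := by
  induction m using Nat.twoStepInduction with
  | zero => exact h0
  | one => exact h1
  | more m hm _ => exact h m hm

/-- The shear is triangular: once the earlier pairs are fixed, each pair is merely translated. For
`dualShear` the same holds from the other end. -/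
theorem avg_shear (c : Bool) (m : ℕ) (π : Bool) (w : Bool × Bool) (f : List Bool → ℝ) :
    avg m (fun x => f (shear c π w x)) = avg m f := by
  induction m using two_step generalizing π w f with
  | h0 => simp [shear]
  | h1 =>
    simp only [avg_succ, avg_zero, shear]
    cases (π && (mulF c w).1) <;> simp [add_comm]
  | h m ih =>
    simp only [avg_two, shear]
    have e := fun (a b a' b' : Bool) => ih (!π) (a, b) (fun l => f (a' :: b' :: l))
    simp only [e]
    cases (π && (mulF c w).1) <;> cases (π && (mulF c w).2) <;> simp <;> ring

theorem avg_dualShear (c : Bool) (m : ℕ) (π : Bool) (f : List Bool → ℝ) :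
    avg m (fun x => f (dualShear c π x)) = avg m f := by
  induction m using two_step generalizing π f with
  | h0 => simp [dualShear]
  | h1 => simp [avg_succ, dualShear]
  | h m ih =>
    have h := avg_two_shift m f (fun r => (!π && (mulF c (headPair r)).1))
      (fun r => (!π && (mulF c (headPair r)).2)) (dualShear c (!π))
    rw [avg_two] at h
    rw [avg_two, avg_two]
    simp only [dualShear]
    rw [h]
    have e := fun (a b : Bool) => ih (!π) (fun l => f (a :: b :: l))
    simp only [e]

/-- Active and inactive positions alternate, so an active pair is changed only by an inactive one,
which stays fixed; adding the same pair twice cancels. -/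
theorem dualShear_involutive (c π : Bool) (l : List Bool) :
    dualShear c π (dualShear c π l) = l := by
  fun_induction dualShear c π l with
  | case1 => rfl
  | case2 => rfl
  | case3 π a b r ih =>
    simp only [dualShear, ih]
    cases π
    · have : headPair (dualShear c true r) = headPair r := by
        match r with
        | [] => rfl
        | [_] => rfl
        | _ :: _ :: _ => simp [dualShear, headPair]
      simp [this]
    · simp

/-- The sign of the inner product of two pairs of bits. -/
def pairSign (u w : Bool × Bool) : ℝ :=
  (if u.1 && w.1 then -1 else 1) * (if u.2 && w.2 then -1 else 1)

/-- The dual shear is the inverse transpose. Both kinds of `mulF` have symmetric matrices, so the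
transpose uses `mulF` again, now adding each pair to the one before it. The sign is the contribution
of the pair `w` in front of the list, which the induction needs. -/
theorem walsh_dualShear (c π : Bool) (w : Bool × Bool) (x ξ : List Bool)
    (h : ξ.length = x.length) :
    walsh (dualShear c π ξ) (shear c π w x) =
      walsh ξ x * (if π then pairSign (headPair ξ) (mulF c w) else 1) := by
  fun_induction shear c π w x generalizing ξ with
  | case1 => 
    obtain rfl : ξ = [] := by simpa using h
    simp [dualShear, walsh, headPair, pairSign]
  | case2 π w a =>
    obtain ⟨d, rfl⟩ : ∃ d, ξ = [d] := List.length_eq_one_iff.mp (by simpa using h)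
    simp only [dualShear, walsh, headPair, pairSign]
    cases π <;> cases a <;> cases d <;> cases (mulF c w).1 <;> simp
  | case3 π w a b r ih =>
    match ξ, h with
    | d :: e :: ρ, h =>
      have hh : headPair (d :: e :: ρ) = (d, e) := rfl
      simp only [dualShear, walsh, hh, ih ρ (by simpa using h)]
      generalize walsh ρ r = W
      generalize headPair ρ = hρ
      obtain ⟨p, q⟩ := hρ
      obtain ⟨w1, w2⟩ := w
      clear ih h hh
      simp only [pairSign, mulF]
      cases π
      · cases c <;> cases a <;> cases b <;> cases d <;> cases e <;> cases p <;> cases q <;> simp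
      · cases c <;> cases a <;> cases b <;> cases d <;> cases e <;> cases w1 <;> cases w2 <;> simp

theorem hat_shear (c π : Bool) (m : ℕ) (f : List Bool → ℝ) (ξ : List Bool) (h : ξ.length = m) :
    hat m (fun x => f (shear c π (false, false) x)) ξ = hat m f (dualShear c π ξ) := by
  unfold hat
  rw [← avg_shear c m π (false, false) (fun x => f x * walsh (dualShear c π ξ) x)]
  refine avg_congr fun x hx => ?_
  rw [walsh_dualShear _ _ _ _ _ (h.trans hx.symm)]
  cases c <;> cases π <;> simp [pairSign, mulF]

/-! ### Drift of the number of leading zero pairs under the dual shears -/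

/-- A weight that grows with the number of leading zero pairs. -/
noncomputable def weight : List Bool → ℝ
  | [] => 1
  | [a] => if a then 1 else 3 / 2
  | a :: b :: r => if a || b then 1 else 3 / 2 * weight r

theorem weight_pos (l : List Bool) : 0 < weight l := by
  fun_induction weight l <;> linarith

/-- The sum of the weights of the four images of a frequency. -/
noncomputable def weightSum (ξ : List Bool) : ℝ :=
  weight (dualShear false false ξ) + weight (dualShear false true ξ) +
    weight (dualShear true false ξ) + weight (dualShear true true ξ)

/-- Consider the first nonzero pair. For one parity, either shear makes the pair before it nonzero,
which multiplies the weight by `2 / 3`. For the other parity a multiple of the following pair is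
added to it; the two multiples differ unless that pair is zero, so at most one shear cancels it,
with factor `3 / 2`, and the other keeps the weight. In total `2 * (2 / 3) + 1 + 3 / 2 = 23 / 6`. -/
theorem weightSum_le (r : List Bool) (h : true ∈ r) :
    weightSum (false :: false :: r) ≤ 23 / 6 * weight (false :: false :: r) := by
  fun_induction weight r with
  | case1 => simp at h
  | case2 => simp [weightSum, dualShear, weight, headPair, mulF]; norm_num
  | case3 a ha => simp_all
  | case4 a b r hab =>
    simp only [weightSum, dualShear, headPair]
    rcases r with _ | ⟨p, _ | ⟨q, r⟩⟩
    · revert hab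
      cases a <;> cases b <;> simp [dualShear, weight, mulF] <;> norm_num
    · revert hab
      cases a <;> cases b <;> cases p <;> simp [dualShear, weight, mulF] <;> norm_num
    · revert hab
      cases a <;> cases b <;> cases p <;> cases q <;> simp [dualShear, weight, headPair, mulF] <;>
        norm_num
  | case5 a b r hab ih =>
    obtain ⟨rfl, rfl⟩ : a = false ∧ b = false := by simpa using hab
    have := ih (by simpa using h)
    -- A further leading zero pair only swaps the two parities and scales all weights by `3 / 2`.
    have e : ∀ c π, weight (dualShear c π (false :: false :: false :: false :: r)) =
        3 / 2 * weight (dualShear c (!π) (false :: false :: r)) := by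
      intro c π
      cases c <;> cases π <;> simp [dualShear, weight, headPair, mulF]
    simp only [weightSum, e] at this ⊢
    simp only [weight] at this ⊢
    simp at this ⊢
    linarith

/-! ### The walk and its spectral gap -/

/-- One step of the expander walk: the first two bits are overwritten by `a` and `b`, and then one
of the four shears is applied. -/
def expStep (a b π c : Bool) (z : List Bool) : List Bool :=
  shear c π (false, false) (a :: b :: z.drop 2)

/-- The expander walk directed by a list of bits. -/
def walk : List Bool → List Bool → List Bool
  | a :: b :: π :: c :: Y, z => walk Y (expStep a b π c z)
  | _, z => z

/-- The averaging operator of one step of the walk. -/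
noncomputable def smooth (g : List Bool → ℝ) (z : List Bool) : ℝ :=
  (avg 2 (fun l => g (shear false false (false, false) (l ++ z.drop 2))) +
    avg 2 (fun l => g (shear false true (false, false) (l ++ z.drop 2))) +
    avg 2 (fun l => g (shear true false (false, false) (l ++ z.drop 2))) +
    avg 2 (fun l => g (shear true true (false, false) (l ++ z.drop 2)))) / 4

theorem avg_walk_succ (t : ℕ) (g : List Bool → ℝ) (z : List Bool) :
    avg (4 * (t + 1)) (fun Y => g (walk Y z)) =
      smooth (fun z => avg (4 * t) (fun Y => g (walk Y z))) z := by
  rw [show 4 * (t + 1) = 4 * t + 1 + 1 + 1 + 1 by ring]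
  simp only [avg_succ, smooth, walk, expStep, avg_zero, List.cons_append, List.nil_append]
  ring

theorem hat_smooth (m : ℕ) (g : List Bool → ℝ) (a b : Bool) (ξ : List Bool) (hξ : ξ.length = m) :
    hat (m + 2) (smooth g) (a :: b :: ξ) = if a || b then 0 else
      (hat (m + 2) g (dualShear false false (false :: false :: ξ)) +
        hat (m + 2) g (dualShear false true (false :: false :: ξ)) +
        hat (m + 2) g (dualShear true false (false :: false :: ξ)) +
        hat (m + 2) g (dualShear true true (false :: false :: ξ))) / 4 := by
  have key : ∀ p q r, smooth g (p :: q :: r) = smooth g (false :: false :: r) := fun p q r => rfl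
  have e : hat (m + 2) (smooth g) (a :: b :: ξ) = if a || b then 0 else
      avg m (fun r => smooth g (false :: false :: r) * walsh ξ r) := by
    unfold hat
    rw [avg_two]
    simp only [key false true, key true false, key true true, walsh]
    have hn : avg m (fun l => -(smooth g (false :: false :: l) * walsh ξ l)) =
        -avg m (fun l => smooth g (false :: false :: l) * walsh ξ l) := by
      rw [neg_eq_neg_one_mul, ← avg_mul_left]; congr 1; ext; ring
    cases a <;> cases b <;> simp [hn]
    ring
  rw [e]
  split_ifs
  · rfl
  · rw [← hat_shear _ _ _ _ _ (by simp [hξ]), ← hat_shear _ _ _ _ _ (by simp [hξ]),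
      ← hat_shear _ _ _ _ _ (by simp [hξ]), ← hat_shear _ _ _ _ _ (by simp [hξ])]
    simp only [hat, avg_two m, ← avg_add, walsh]
    rw [div_eq_inv_mul, div_eq_inv_mul, div_eq_inv_mul, div_eq_inv_mul, div_eq_inv_mul]
    simp only [← avg_mul_left, ← avg_add]
    congr 1
    ext r
    simp [smooth, avg_succ]
    ring

/-- The frequencies that survive a step of the walk: nonzero, with vanishing first pair. -/
def Survives (ξ : List Bool) : Prop := ∃ r, ξ = false :: false :: r ∧ true ∈ r

theorem dualShear_of_zero (c π : Bool) (ξ : List Bool) (h : true ∉ ξ) : dualShear c π ξ = ξ := by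
  fun_induction dualShear c π ξ with
  | case1 => rfl
  | case2 => rfl
  | case3 π a b r ih =>
    simp only [List.mem_cons, not_or] at h
    have hr : headPair r = (false, false) := by
      match r with
      | [] => rfl
      | [x] => simp_all [headPair]
      | x :: y :: r => simp_all [headPair]
    rw [ih h.2.2, hr]
    cases c <;> simp [mulF]

/-- Overwriting the first pair removes the frequencies that are nonzero there, and mean zero removes
the zero frequency, which every dual shear fixes. One step thus provides the support condition of
the contraction estimate. -/
theorem survives_of_hat_smooth (m : ℕ) (g : List Bool → ℝ) (h0 : avg (m + 2) g = 0)
    (ξ : List Bool) (hξ : ξ.length = m + 2) (h : hat (m + 2) (smooth g) ξ ≠ 0) : Survives ξ := by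
  match ξ, hξ with
  | a :: b :: r, hξ =>
    have hr : r.length = m := by simpa using hξ
    rw [hat_smooth m g a b r hr] at h
    have hab : (a || b) = false := by by_contra hc; simp_all
    obtain ⟨rfl, rfl⟩ : a = false ∧ b = false := by simpa using hab
    refine ⟨r, rfl, ?_⟩
    by_contra ht
    have hz : true ∉ false :: false :: r := by simpa using ht
    have hw : ∀ ζ x : List Bool, true ∉ ζ → walsh ζ x = 1 := by
      intro ζ x hζ
      fun_induction walsh ζ x <;> simp_all
    apply h
    simp only [dualShear_of_zero _ _ _ hz]
    have : hat (m + 2) g (false :: false :: r) = 0 := by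
      unfold hat
      simpa only [hw _ _ hz, mul_one] using h0
    simp [this]

-- A Schur test. Cauchy–Schwarz with the weights of the four images gives a factor `23 / 6` against
-- `weight ξ`. Moving each term to the image frequency `η`, by an involution that preserves
-- averages, gives a second factor `23 / 6`, now from the weight bound at `η`. With the `1 / 16`
-- from averaging four terms this is `(23 / 24) ^ 2`. The weight bound needs surviving frequencies,
-- hence the support hypothesis.
open Classical in
theorem avg_hat_smooth_le (m : ℕ) (g : List Bool → ℝ)
    (hg : ∀ ξ, ξ.length = m + 2 → hat (m + 2) g ξ ≠ 0 → Survives ξ) :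
    avg (m + 2) (fun ξ => hat (m + 2) (smooth g) ξ ^ 2) ≤
      (23 / 24) ^ 2 * avg (m + 2) (fun ξ => hat (m + 2) g ξ ^ 2) := by
  set H := hat (m + 2) g with hH
  let Ψ : Bool → Bool → List Bool → ℝ := fun c π η =>
    if Survives (dualShear c π η) then weight (dualShear c π η) * (H η ^ 2 / weight η) else 0
  have hΨ : ∀ c π ξ, Ψ c π (dualShear c π ξ) = if Survives ξ then
      weight ξ * (H (dualShear c π ξ) ^ 2 / weight (dualShear c π ξ)) else 0 := by
    intro c π ξ; simp only [Ψ, dualShear_involutive]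
  have hpt : ∀ ξ, ξ.length = m + 2 → hat (m + 2) (smooth g) ξ ^ 2 ≤ 23 / 96 *
      (Ψ false false (dualShear false false ξ) + Ψ false true (dualShear false true ξ) +
        Ψ true false (dualShear true false ξ) + Ψ true true (dualShear true true ξ)) := by
    intro ξ hξ
    simp only [hΨ]
    by_cases hs : Survives ξ
    · obtain ⟨r, rfl, hr⟩ := id hs
      simp only [if_pos hs]
      rw [hat_smooth m g _ _ r (by simpa using hξ)]
      have hw := weightSum_le r hr
      unfold weightSum at hw
      rw [← hH]
      simp only [Bool.or_self, Bool.false_eq_true, if_false]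
      have p1 := weight_pos (dualShear false false (false :: false :: r))
      have p2 := weight_pos (dualShear false true (false :: false :: r))
      have p3 := weight_pos (dualShear true false (false :: false :: r))
      have p4 := weight_pos (dualShear true true (false :: false :: r))
      revert p1 p2 p3 p4 hw
      generalize weight (dualShear false false (false :: false :: r)) = w1
      generalize weight (dualShear false true (false :: false :: r)) = w2
      generalize weight (dualShear true false (false :: false :: r)) = w3
      generalize weight (dualShear true true (false :: false :: r)) = w4
      generalize H (dualShear false false (false :: false :: r)) = h1
      generalize H (dualShear false true (false :: false :: r)) = h2
      generalize H (dualShear true false (false :: false :: r)) = h3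
      generalize H (dualShear true true (false :: false :: r)) = h4
      generalize weight (false :: false :: r) = w
      intro hw p1 p2 p3 p4
      have cs : (h1 + h2 + h3 + h4) ^ 2 ≤
          (w1 + w2 + w3 + w4) * (h1 ^ 2 / w1 + h2 ^ 2 / w2 + h3 ^ 2 / w3 + h4 ^ 2 / w4) := by
        have := Finset.sq_sum_div_le_sum_sq_div Finset.univ ![h1, h2, h3, h4]
          (g := ![w1, w2, w3, w4]) (by simp [Fin.forall_fin_succ, p1, p2, p3, p4])
        simp only [Fin.sum_univ_four] at this
        rw [div_le_iff₀ (by simp; positivity)] at this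
        simpa [mul_comm] using this
      have hnn : 0 ≤ h1 ^ 2 / w1 + h2 ^ 2 / w2 + h3 ^ 2 / w3 + h4 ^ 2 / w4 := by positivity
      have := mul_le_mul_of_nonneg_right hw hnn
      calc ((h1 + h2 + h3 + h4) / 4) ^ 2 = (h1 + h2 + h3 + h4) ^ 2 / 16 := by ring
        _ ≤ (23 / 6 * w * (h1 ^ 2 / w1 + h2 ^ 2 / w2 + h3 ^ 2 / w3 + h4 ^ 2 / w4)) / 16 := by
          gcongr; exact cs.trans this
        _ = _ := by ring
    · simp only [if_neg hs]
      have : hat (m + 2) (smooth g) ξ = 0 := by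
        -- A nonzero mean would be a nonzero coefficient at the zero frequency, which does not
        -- survive.
        by_contra hne
        refine hs (survives_of_hat_smooth m g ?_ ξ hξ hne)
        by_contra h0
        have h1 : hat (m + 2) g (List.replicate (m + 2) false) ≠ 0 := by
          unfold hat
          have hw : ∀ k x, walsh (List.replicate k false) x = 1 := by
            intro k
            induction k with
            | zero => intro x; simp [walsh]
            | succ k ih => intro x; cases x <;> simp [List.replicate_succ, walsh, ih]
          simpa only [hw, mul_one] using h0
        obtain ⟨r, e, hr⟩ := hg _ (by simp) h1
        have : true ∈ List.replicate (m + 2) false := by rw [e]; simp [hr]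
        simp at this
      simp [this]
  refine (avg_mono hpt).trans ?_
  rw [avg_mul_left, avg_add, avg_add, avg_add, avg_dualShear, avg_dualShear, avg_dualShear,
    avg_dualShear, ← avg_add, ← avg_add, ← avg_add]
  have hpt2 : ∀ η, η.length = m + 2 →
      Ψ false false η + Ψ false true η + Ψ true false η + Ψ true true η ≤ 23 / 6 * H η ^ 2 := by
    intro η hη
    by_cases h0 : H η = 0
    · simp [Ψ, h0]
    · obtain ⟨r, rfl, hr⟩ := hg η hη h0
      have hw := weightSum_le r hr
      have p := weight_pos (false :: false :: r)
      have hb : ∀ c π, Ψ c π (false :: false :: r) ≤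
          weight (dualShear c π (false :: false :: r)) *
            (H (false :: false :: r) ^ 2 / weight (false :: false :: r)) := by
        intro c π
        simp only [Ψ]
        split_ifs
        · exact le_rfl
        · have := weight_pos (dualShear c π (false :: false :: r))
          positivity
      have h1 := hb false false
      have h2 := hb false true
      have h3 := hb true false
      have h4 := hb true true
      have := mul_le_mul_of_nonneg_right hw
        (show 0 ≤ H (false :: false :: r) ^ 2 / weight (false :: false :: r) by positivity)
      have e : 23 / 6 * weight (false :: false :: r) *
          (H (false :: false :: r) ^ 2 / weight (false :: false :: r)) =
          23 / 6 * H (false :: false :: r) ^ 2 := by field_simp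
      rw [e, weightSum] at this
      linarith
  have := avg_mono hpt2
  rw [avg_mul_left] at this
  linarith

theorem avg_smooth_sq_le (m : ℕ) (g : List Bool → ℝ)
    (hg : ∀ ξ, ξ.length = m + 2 → hat (m + 2) g ξ ≠ 0 → Survives ξ) :
    avg (m + 2) (fun x => smooth g x ^ 2) ≤ (23 / 24) ^ 2 * avg (m + 2) (fun x => g x ^ 2) := by
  rw [parseval, parseval (m + 2) g]
  have := mul_le_mul_of_nonneg_left (avg_hat_smooth_le m g hg)
    (show (0 : ℝ) ≤ 2 ^ (m + 2) by positivity)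
  linarith

theorem avg_smooth (m : ℕ) (g : List Bool → ℝ) : avg (m + 2) (smooth g) = avg (m + 2) g := by
  have e : ∀ c π, avg (m + 2) (fun z => avg 2 (fun l => g (shear c π (false, false) (l ++ z.drop 2)))) =
      avg (m + 2) g := by
    intro c π
    rw [avg_two]
    simp only [List.drop_succ_cons, List.drop_zero]
    rw [avg_comm, ← avg_append 2 m (fun l => g (shear c π (false, false) l)), Nat.add_comm 2 m,
      avg_shear]
    ring
  have h : smooth g = fun z => (1 / 4 : ℝ) *
      (avg 2 (fun l => g (shear false false (false, false) (l ++ z.drop 2))) +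
    avg 2 (fun l => g (shear false true (false, false) (l ++ z.drop 2))) +
    avg 2 (fun l => g (shear true false (false, false) (l ++ z.drop 2))) +
    avg 2 (fun l => g (shear true true (false, false) (l ++ z.drop 2)))) := by
    ext z; simp only [smooth]; ring
  rw [h, avg_mul_left, avg_add, avg_add, avg_add, e, e, e, e]
  ring

theorem expStep_length {z : List Bool} (h : 2 ≤ z.length) (a b π c : Bool) :
    (expStep a b π c z).length = z.length := by
  simp [expStep, shear_length]; omega

theorem walk_length (Y : List Bool) {z : List Bool} (h : 2 ≤ z.length) :
    (walk Y z).length = z.length := by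
  fun_induction walk Y z with
  | case1 a b π c Y z ih => rw [ih (by rwa [expStep_length h]), expStep_length h]
  | case2 => rfl

/-- One of the `t + 1` steps is spent on restricting the support of the Walsh coefficients; each of
the others contracts the squared norm by `(23 / 24) ^ 2`. -/
theorem avg_sq_walk_le (m t : ℕ) (g : List Bool → ℝ) (h0 : avg (m + 2) g = 0)
    (h1 : ∀ x, x.length = m + 2 → |g x| ≤ 1) :
    avg (m + 2) (fun x => avg (4 * (t + 1)) (fun Y => g (walk Y x)) ^ 2) ≤ (23 / 24) ^ (2 * t) := by
  have hmean : ∀ t, avg (m + 2) (fun x => avg (4 * t) (fun Y => g (walk Y x))) = 0 := by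
    intro t
    induction t with
    | zero => simpa [walk] using h0
    | succ t ih => simp only [avg_walk_succ]; rw [avg_smooth, ih]
  induction t with
  | zero =>
    have : ∀ x, x.length = m + 2 → avg (4 * (0 + 1)) (fun Y => g (walk Y x)) ^ 2 ≤ 1 := by
      intro x hx
      rw [sq_le_one_iff_abs_le_one]
      refine (abs_avg_le _ _).trans ?_
      have := avg_mono (m := 4 * (0 + 1)) (f := fun Y => |g (walk Y x)|) (g := fun _ => 1)
        (fun Y _ => h1 _ (by rw [walk_length Y (by omega), hx]))
      simpa using this
    simpa using avg_mono this
  | succ t ih =>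
    simp only [avg_walk_succ (t + 1)]
    refine (avg_smooth_sq_le m _ ?_).trans ?_
    · intro ξ hξ hne
      simp only [avg_walk_succ t] at hne
      exact survives_of_hat_smooth m _ (hmean t) ξ hξ hne
    · rw [show 2 * (t + 1) = 2 + 2 * t by ring, pow_add]
      gcongr

/-- The expander mixing property of the walk. -/
theorem mixing (m t : ℕ) (f g : List Bool → ℝ) (hf : ∀ x, x.length = m + 2 → |f x| ≤ 1)
    (hg : ∀ x, x.length = m + 2 → 0 ≤ g x ∧ g x ≤ 1) :
    |avg (m + 2) (fun x => f x * avg (4 * (t + 1)) (fun Y => g (walk Y x))) -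
      avg (m + 2) f * avg (m + 2) g| ≤ (23 / 24) ^ t := by
  set E := avg (m + 2) g with hE
  have hE0 : 0 ≤ E := avg_nonneg fun x hx => (hg x hx).1
  have hE1 : E ≤ 1 := by simpa using avg_mono (g := fun _ => 1) fun x hx => (hg x hx).2
  have h := avg_sq_walk_le m t (fun x => g x - E) (by rw [avg_sub, avg_const, hE, sub_self])
    (fun x hx => by have := hg x hx; rw [abs_le]; constructor <;> linarith)
  simp only [avg_sub, avg_const] at h
  rw [mul_comm (avg (m + 2) f), ← avg_mul_left, ← avg_sub]
  refine (abs_avg_le _ _).trans ?_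
  set W := fun x => avg (4 * (t + 1)) (fun Y => g (walk Y x)) with hW
  have hl : (0 : ℝ) < (23 / 24) ^ t := by positivity
  -- The inequality `d ≤ l / 2 + d ^ 2 / (2 * l)` with `l = (23 / 24) ^ t` stands in for
  -- Cauchy–Schwarz; the mean of `d ^ 2` is at most `l ^ 2`, so both terms contribute `l / 2`.
  have hpt : ∀ x, x.length = m + 2 → |f x * W x - E * f x| ≤
      1 / 2 * (23 / 24) ^ t + (1 / 2 * ((23 / 24) ^ t)⁻¹) * (W x - E) ^ 2 := by
    intro x hx
    have e : f x * W x - E * f x = f x * (W x - E) := by ring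
    rw [e, abs_mul]
    have h1 : |f x| * |W x - E| ≤ |W x - E| := by
      have := hf x hx
      have h2 := abs_nonneg (W x - E)
      nlinarith
    refine h1.trans ?_
    rw [← sq_abs (W x - E)]
    generalize |W x - E| = d
    generalize ((23 / 24 : ℝ)) ^ t = l at hl
    have : 1 / 2 * l + 1 / 2 * l⁻¹ * d ^ 2 - d = (l - d) ^ 2 / (2 * l) := by field_simp; ring
    have h2 : 0 ≤ (l - d) ^ 2 / (2 * l) := by positivity
    linarith
  refine (avg_mono hpt).trans ?_
  rw [avg_add, avg_const, avg_mul_left]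
  have : (1 / 2 * ((23 / 24 : ℝ) ^ t)⁻¹) * avg (m + 2) (fun x => (W x - E) ^ 2) ≤
      (1 / 2 * ((23 / 24 : ℝ) ^ t)⁻¹) * (23 / 24) ^ (2 * t) := by gcongr
  have e : (1 / 2 * ((23 / 24 : ℝ) ^ t)⁻¹) * (23 / 24) ^ (2 * t) = 1 / 2 * (23 / 24) ^ t := by
    rw [two_mul, pow_add]; field_simp
  linarith

/-! ### The generator -/

/-- Move `a` bits, one by one, from the list `z` to the list `y`; missing bits are read as `0`. -/
def pull : ℕ → List Bool → List Bool → List Bool × List Bool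
  | 0, z, y => (z, y)
  | a + 1, z, y => pull a z.tail (z.headD false :: y)

/-- The first `n` bits of a list, padded by zeros. -/
def emit : ℕ → List Bool → List Bool
  | 0, _ => []
  | n + 1, z => z.headD false :: emit n z.tail

/-- The `j`-th of the `2 ^ i` blocks generated from `z`, where the walk at level `l` has
`t l` steps. -/
def block (n : ℕ) (t : ℕ → ℕ) : ℕ → ℕ → List Bool → List Bool
  | 0, _, z => emit n z
  | i + 1, j, z =>
    block n t i j (if j.testBit i then walk (pull (4 * t i) z []).2 (pull (4 * t i) z []).1
      else (pull (4 * t i) z []).1)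

/-- The `2 ^ i` blocks generated from `z`. -/
def blocks (n : ℕ) (t : ℕ → ℕ) : ℕ → List Bool → List (List Bool)
  | 0, z => [emit n z]
  | i + 1, z => blocks n t i (pull (4 * t i) z []).1 ++
      blocks n t i (walk (pull (4 * t i) z []).2 (pull (4 * t i) z []).1)

theorem emit_length (n : ℕ) (z : List Bool) : (emit n z).length = n := by
  induction n generalizing z with
  | zero => rfl
  | succ n ih => simp [emit, ih]

theorem block_length (n : ℕ) (t : ℕ → ℕ) (i j : ℕ) (z : List Bool) :
    (block n t i j z).length = n := by
  induction i generalizing z with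
  | zero => exact emit_length n z
  | succ i ih => exact ih _

theorem blocks_length (n : ℕ) (t : ℕ → ℕ) (i : ℕ) (z : List Bool) :
    (blocks n t i z).length = 2 ^ i := by
  induction i generalizing z with
  | zero => rfl
  | succ i ih => simp [blocks, ih, pow_succ]; ring

theorem block_add_pow (n : ℕ) (t : ℕ → ℕ) (i l j : ℕ) (h : i ≤ l) (z : List Bool) :
    block n t i (2 ^ l + j) z = block n t i j z := by
  induction i generalizing z with
  | zero => rfl
  | succ i ih =>
    simp only [block]
    rw [ih (by omega), Nat.testBit_two_pow_add_gt (by omega)]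

theorem blocks_eq_map (n : ℕ) (t : ℕ → ℕ) (i : ℕ) (z : List Bool) :
    blocks n t i z = (List.range (2 ^ i)).map fun j => block n t i j z := by
  induction i generalizing z with
  | zero => simp [blocks, block]
  | succ i ih =>
    rw [pow_succ, mul_two, List.range_add, List.map_append, List.map_map, blocks, ih, ih]
    congr 1
    · refine List.map_congr_left fun j hj => ?_
      rw [block, Nat.testBit_lt_two_pow (List.mem_range.mp hj)]
      simp
    · refine List.map_congr_left fun j hj => ?_
      simp only [Function.comp, block]
      rw [block_add_pow _ _ _ _ _ le_rfl, Nat.testBit_two_pow_add_eq,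
        Nat.testBit_lt_two_pow (List.mem_range.mp hj)]
      simp

/-- The pulled bits arrive in reverse order, which a uniform average does not notice. -/
theorem avg_pull (a m : ℕ) (Φ : List Bool × List Bool → ℝ) (Y : List Bool) :
    avg (a + m) (fun z => Φ (pull a z Y)) = avg a (fun y => avg m (fun x => Φ (x, y ++ Y))) := by
  induction a generalizing Y with
  | zero => simp [pull]
  | succ a ih =>
    rw [Nat.add_right_comm, avg_succ, avg_snoc]
    simp only [pull, List.tail_cons, List.headD_cons, ih, List.append_assoc, List.singleton_append]

theorem emit_append (n : ℕ) (x y : List Bool) (h : x.length = n) : emit n (x ++ y) = x := by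
  induction n generalizing x with
  | zero => simp_all [emit]
  | succ n ih =>
    match x, h with
    | a :: x, h => simp [emit, ih x (by simpa using h)]

/-! ### Test functions computed by block decision trees -/

/-- The functions of `k` blocks, with values in `[0, 1]`, that a block decision tree computes. -/
def IsTest (A : Type u) : ℕ → (List (List Bool) → ℝ) → Prop
  | 0, F => 0 ≤ F [] ∧ F [] ≤ 1
  | k + 1, F => ∃ (f : List Bool → A) (G : A → List (List Bool) → ℝ),
      (∀ a, IsTest A k (G a)) ∧ ∀ X Xs, F (X :: Xs) = G (f X) Xs

/-- The average of `F` over `k` independent uniform blocks of `n` bits. -/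
noncomputable def avgBlocks (n : ℕ) : ℕ → (List (List Bool) → ℝ) → ℝ
  | 0, F => F []
  | k + 1, F => avg n (fun X => avgBlocks n k (fun Xs => F (X :: Xs)))

theorem IsTest.mem_unit {A : Type u} {k : ℕ} {F : List (List Bool) → ℝ} (h : IsTest A k F)
    (Xs : List (List Bool)) (hX : Xs.length = k) : 0 ≤ F Xs ∧ F Xs ≤ 1 := by
  induction k generalizing F Xs with
  | zero => obtain rfl := List.length_eq_zero_iff.mp hX; exact h
  | succ k ih =>
    obtain ⟨f, G, hG, e⟩ := h
    match Xs, hX with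
    | X :: Xs, hX => rw [e]; exact ih (hG _) Xs (by simpa using hX)

theorem avgBlocks_congr {n k : ℕ} {F G : List (List Bool) → ℝ}
    (h : ∀ Xs, Xs.length = k → F Xs = G Xs) : avgBlocks n k F = avgBlocks n k G := by
  induction k generalizing F G with
  | zero => exact h [] rfl
  | succ k ih =>
    simp only [avgBlocks]
    refine avg_congr fun X _ => ih fun Xs hX => h _ (by simp [hX])

theorem avgBlocks_append (n k l : ℕ) (F : List (List Bool) → ℝ) :
    avgBlocks n (l + k) F = avgBlocks n k (fun X => avgBlocks n l (fun X' => F (X ++ X'))) := by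
  induction k generalizing F with
  | zero => rfl
  | succ k ih =>
    rw [← Nat.add_assoc]
    simp only [avgBlocks, ih, List.cons_append]

theorem avgBlocks_const (n k : ℕ) (c : ℝ) : avgBlocks n k (fun _ => c) = c := by
  induction k with
  | zero => rfl
  | succ k ih => simp [avgBlocks, ih]

theorem avgBlocks_mono {n k : ℕ} {F G : List (List Bool) → ℝ}
    (h : ∀ Xs, Xs.length = k → F Xs ≤ G Xs) : avgBlocks n k F ≤ avgBlocks n k G := by
  induction k generalizing F G with
  | zero => exact h [] rfl
  | succ k ih => exact avg_mono fun X _ => ih fun Xs hX => h _ (by simp [hX])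

theorem IsTest.avgBlocks_mem_unit {A : Type u} {k : ℕ} {F : List (List Bool) → ℝ}
    (h : IsTest A k F) (n : ℕ) : 0 ≤ avgBlocks n k F ∧ avgBlocks n k F ≤ 1 := by
  have h0 := avgBlocks_mono (n := n) (F := fun _ => 0) fun Xs hX => (h.mem_unit Xs hX).1
  have h1 := avgBlocks_mono (n := n) (G := fun _ => 1) fun Xs hX => (h.mem_unit Xs hX).2
  rw [avgBlocks_const] at h0 h1
  exact ⟨h0, h1⟩

/-- A block decision tree of height `a + b` is a tree of height `a` followed by trees of
height `b`. -/
theorem IsTest.split {A : Type u} (b a : ℕ) {F : List (List Bool) → ℝ} (h : IsTest A (b + a) F) :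
    ∃ (T : List (List Bool) → List.Vector A a)
      (G : List.Vector A a → List (List Bool) → ℝ),
      (∀ v, IsTest A b (G v)) ∧ (∀ X X', X.length = a → F (X ++ X') = G (T X) X') ∧
      ∀ q : List.Vector A a → ℝ, (∀ v, 0 ≤ q v ∧ q v ≤ 1) → IsTest A a (fun X => q (T X)) := by
  induction a generalizing F with
  | zero =>
    refine ⟨fun _ => List.Vector.nil, fun _ => F, fun _ => h, fun X X' hX => ?_, fun q hq => hq _⟩
    obtain rfl := List.length_eq_zero_iff.mp hX
    rfl
  | succ a ih =>
    obtain ⟨f, G, hG, e⟩ := h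
    choose T G' h1 h2 h3 using fun x => ih (hG x)
    refine ⟨fun X => f (X.headD []) ::ᵥ T (f (X.headD [])) X.tail,
      fun v => G' v.head v.tail, fun v => h1 _ _, fun X X' hX => ?_, fun q hq => ?_⟩
    · match X, hX with
      | X :: Xs, hX =>
        simp only [List.cons_append, e, h2 _ Xs X' (by simpa using hX), List.headD_cons,
          List.tail_cons, List.Vector.head_cons, List.Vector.tail_cons]
    · exact ⟨f, fun x Xs => q (x ::ᵥ T x Xs),
        fun x => h3 x (fun v => q (x ::ᵥ v)) fun v => hq _, fun X Xs => rfl⟩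

theorem isTest_const {A : Type u} [Nonempty A] (k : ℕ) {c : ℝ} (h : 0 ≤ c ∧ c ≤ 1) :
    IsTest A k (fun _ => c) := by
  induction k with
  | zero => exact h
  | succ k ih => exact ⟨fun _ => Classical.arbitrary A, fun _ _ => c, fun _ => ih, fun _ _ => rfl⟩

/-- Padding by levels whose label is constant brings a tree up to a height that is a power of two.
-/
theorem IsTest.take {A : Type u} [Nonempty A] (j k : ℕ) {F : List (List Bool) → ℝ}
    (h : IsTest A k F) : IsTest A (j + k) (fun Xs => F (Xs.take k)) := by
  induction k generalizing F with
  | zero => simpa using isTest_const j h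
  | succ k ih =>
    obtain ⟨f, G, hG, e⟩ := h
    exact ⟨f, fun a Xs => G a (Xs.take k), fun a => ih (hG a), fun X Xs => by simp [e]⟩

theorem avgBlocks_take (n j k : ℕ) (F : List (List Bool) → ℝ) :
    avgBlocks n (j + k) (fun Xs => F (Xs.take k)) = avgBlocks n k F := by
  rw [avgBlocks_append]
  refine avgBlocks_congr fun X hX => ?_
  simp [← hX, avgBlocks_const]

/-! ### The error of the generator -/

/-- The seed length for `2 ^ i` blocks. -/
def seedLength (n : ℕ) (t : ℕ → ℕ) (i : ℕ) : ℕ := n + 2 + ∑ l ∈ Finset.range i, 4 * t l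

-- Conditioning on the labels `v` read in the first half writes the acceptance probability as a sum
-- over `v` of correlations between `f v` at `x` and `g v` at the end of the walk. Three
-- replacements follow: independent halves by mixing, a uniform second half by induction for each `G
-- v`, and a uniform first half by induction.
open Classical in
theorem generator_error {A : Type u} [Fintype A] (n : ℕ) (t : ℕ → ℕ) (e : ℕ → ℝ) (r : ℕ)
    (h0 : 0 ≤ e 0)
    (he : ∀ i < r, 2 * e i + Fintype.card A ^ 2 ^ i * (23 / 24) ^ t i ≤ e (i + 1))
    (i : ℕ) (hi : i ≤ r) (F : List (List Bool) → ℝ) (hF : IsTest A (2 ^ i) F) :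
    |avg (seedLength n (fun l => t l + 1) i) (fun z => F (blocks n (fun l => t l + 1) i z)) -
      avgBlocks n (2 ^ i) F| ≤ e i := by
  induction i generalizing F with
  | zero =>
    have : avg (seedLength n (fun l => t l + 1) 0)
        (fun z => F (blocks n (fun l => t l + 1) 0 z)) = avgBlocks n (2 ^ 0) F := by
      simp only [seedLength, Finset.sum_range_zero, add_zero, blocks, pow_zero, avgBlocks]
      rw [avg_append]
      refine avg_congr fun x hx => ?_
      simp [emit_append n x _ hx]
    rw [this, sub_self, abs_zero]
    exact h0
  | succ i ih =>
    replace ih := ih (by omega)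
    have hm : seedLength n (fun l => t l + 1) (i + 1) =
        4 * (t i + 1) + seedLength n (fun l => t l + 1) i := by
      simp only [seedLength, Finset.sum_range_succ]; ring
    obtain ⟨m, hmi⟩ : ∃ m, seedLength n (fun l => t l + 1) i = m + 2 :=
      ⟨n + ∑ l ∈ Finset.range i, 4 * (t l + 1), by simp only [seedLength]; ring⟩
    set B := blocks n (fun l => t l + 1) i with hB
    have hBl : ∀ z, (B z).length = 2 ^ i := fun z => blocks_length _ _ _ _
    rw [pow_succ, mul_two] at hF ⊢
    obtain ⟨T, G, hG, hFG, hq⟩ := hF.split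
    set β := fun v => avgBlocks n (2 ^ i) (G v) with hβ
    have hβu : ∀ v, 0 ≤ β v ∧ β v ≤ 1 := fun v => (hG v).avgBlocks_mem_unit n
    have hright : avgBlocks n (2 ^ i + 2 ^ i) F = avgBlocks n (2 ^ i) (fun X => β (T X)) := by
      rw [avgBlocks_append]
      exact avgBlocks_congr fun X hX => avgBlocks_congr fun X' _ => hFG X X' hX
    set f : List.Vector A (2 ^ i) → List Bool → ℝ := fun v x => if T (B x) = v then 1 else 0 with hf
    set g : List.Vector A (2 ^ i) → List Bool → ℝ := fun v x => G v (B x) with hg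
    have hleft : avg (seedLength n (fun l => t l + 1) (i + 1))
        (fun z => F (blocks n (fun l => t l + 1) (i + 1) z)) =
        ∑ v, avg (m + 2) (fun x => f v x * avg (4 * (t i + 1)) (fun Y => g v (walk Y x))) := by
      rw [hm, hmi]
      simp only [blocks, ← hB]
      rw [avg_pull (4 * (t i + 1)) (m + 2) (fun p => F (B p.1 ++ B (walk p.2 p.1))), avg_comm,
        ← avg_sum]
      refine avg_congr fun x _ => ?_
      simp only [hf, ite_mul, one_mul, zero_mul, Finset.sum_ite_eq, Finset.mem_univ, if_true,
        List.append_nil]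
      exact avg_congr fun Y _ => hFG _ _ (hBl x)
    have hgu : ∀ v x, 0 ≤ g v x ∧ g v x ≤ 1 := fun v x => (hG v).mem_unit _ (hBl x)
    have hmix : ∀ v, |avg (m + 2) (fun x => f v x * avg (4 * (t i + 1)) (fun Y => g v (walk Y x))) -
        avg (m + 2) (f v) * avg (m + 2) (g v)| ≤ (23 / 24) ^ t i := fun v =>
      mixing m (t i) (f v) (g v) (fun x _ => by simp only [hf]; split_ifs <;> simp)
        (fun x _ => hgu v x)
    have hfn : ∀ v, 0 ≤ avg (m + 2) (f v) := fun v =>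
      avg_nonneg fun x _ => by simp only [hf]; split_ifs <;> simp
    have hfs : ∑ v, avg (m + 2) (f v) = 1 := by
      rw [← avg_sum]; simp [hf]
    have hgb : ∀ v, |avg (m + 2) (g v) - β v| ≤ e i := fun v => by
      have := ih (G v) (hG v)
      rwa [hmi] at this
    -- The conditional success probability `β` of the second half, placed at the leaves of the first
    -- half, is again a test; this is why tests take values in `[0, 1]` and not just `0` and `1`.
    have hlast : |∑ v, avg (m + 2) (f v) * β v - avgBlocks n (2 ^ i) (fun X => β (T X))| ≤ e i := by
      have := ih _ (hq β hβu)
      rw [hmi] at this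
      convert this using 4
      simp only [mul_comm _ (β _), ← avg_mul_left, ← avg_sum]
      refine avg_congr fun x _ => ?_
      simp [hf]
    rw [hleft, hright]
    have s1 : |∑ v, avg (m + 2) (fun x => f v x * avg (4 * (t i + 1)) (fun Y => g v (walk Y x))) -
        ∑ v, avg (m + 2) (f v) * avg (m + 2) (g v)| ≤
        Fintype.card A ^ 2 ^ i * (23 / 24) ^ t i := by
      rw [← Finset.sum_sub_distrib]
      refine (Finset.abs_sum_le_sum_abs _ _).trans ?_
      refine (Finset.sum_le_sum fun v _ => hmix v).trans ?_
      simp [card_vector]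
    -- The state probabilities sum to one, so `e i` is paid once and not once per state.
    have s2 : |∑ v, avg (m + 2) (f v) * avg (m + 2) (g v) - ∑ v, avg (m + 2) (f v) * β v| ≤ e i := by
      rw [← Finset.sum_sub_distrib]
      refine (Finset.abs_sum_le_sum_abs _ _).trans ?_
      calc ∑ v, |avg (m + 2) (f v) * avg (m + 2) (g v) - avg (m + 2) (f v) * β v|
          ≤ ∑ v, avg (m + 2) (f v) * e i := by
            refine Finset.sum_le_sum fun v _ => ?_
            rw [← mul_sub, abs_mul, abs_of_nonneg (hfn v)]
            exact mul_le_mul_of_nonneg_left (hgb v) (hfn v)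
        _ = e i := by rw [← Finset.sum_mul, hfs, one_mul]
    have := he i (by omega)
    rw [abs_le] at *
    constructor <;> linarith [s1.1, s1.2, s2.1, s2.2, hlast.1, hlast.2]

/-! ### The Turing machine -/

/-- Instructions on the control stack of the machine. -/
inductive Instr
  | seed (b : Bool)
  | pull
  | level (b : Bool)
  | emit
  deriving Fintype

/-- Marks that count in unary. -/
inductive Mark
  | half
  | double
  | keep
  deriving DecidableEq

instance : Fintype Mark := ⟨{.half, .double, .keep}, fun x => by cases x <;> decide⟩

/-- The stacks of the machine. -/
inductive Stack
  | inp | out | ctl | done | cur | dir | tmp | res | cnt | q | r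
  deriving DecidableEq

instance : Fintype Stack :=
  ⟨{.inp, .out, .ctl, .done, .cur, .dir, .tmp, .res, .cnt, .q, .r}, fun x => by cases x <;> decide⟩

/-- The alphabets of the stacks. -/
abbrev Stack.Alphabet : Stack → Type
  | .inp => Option Bool
  | .ctl | .done => Instr
  | .cnt | .q | .r => Mark
  | .out | .cur | .dir | .tmp | .res => Bool

/-- The labels of the program. -/
inductive Label
  | readN | readK₀ | readK | readQ | readL | flip | level | expand | clearR | readX | next
  | run | clearDir | walk | pass | back | rewind | clearCur | write | clearCtl
  deriving DecidableEq

instance : Fintype Label :=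
  ⟨{.readN, .readK₀, .readK, .readQ, .readL, .flip, .level, .expand, .clearR, .readX, .next,
    .run, .clearDir, .walk, .pass, .back, .rewind, .clearCur, .write, .clearCtl},
    fun x => by cases x <;> decide⟩

/-- The registers of the machine. -/
structure Reg where
  inp : Option (Option Bool) := none
  ins : Option Instr := none
  mark : Option Mark := none
  y : Option Bool := none
  y' : Option Bool := none
  b : Bool := false
  flag : Bool := false
  c : Bool := false
  w : Bool × Bool := (false, false)

noncomputable instance : Fintype Reg :=
  Fintype.ofInjective
    (fun r => ((r.inp, r.ins, r.mark), (r.y, r.y', r.b), (r.flag, r.c, r.w)))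
    fun r r' h => by cases r; cases r'; simp_all

open Turing.TM2.Stmt in
/-- Push `a` several times. -/
def pushMany (k : Stack) (a : k.Alphabet) :
    ℕ → Turing.TM2.Stmt Stack.Alphabet Label Reg → Turing.TM2.Stmt Stack.Alphabet Label Reg
  | 0, s => s
  | m + 1, s => push k (fun _ => a) (pushMany k a m s)

open Turing.TM2.Stmt in
/-- Reset the registers and jump. -/
def jump (l : Label) : Turing.TM2.Stmt Stack.Alphabet Label Reg :=
  load (fun _ => {}) (goto fun _ => l)

/-- Whether an input symbol is a bit. -/
def isBit : Option (Option Bool) → Bool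
  | some (some _) => true
  | _ => false

/-- The value of an input symbol. -/
def bitOf : Option (Option Bool) → Bool
  | some (some b) => b
  | _ => false

open Turing.TM2.Stmt in
/-- The program of the machine. -/
def prog : Label → Turing.TM2.Stmt Stack.Alphabet Label Reg
  | .readN => pop .inp (fun r o => { r with inp := o }) <| branch (fun r => isBit r.inp)
      (push .ctl (fun _ => .emit) <| jump .readN) (jump .readK₀)
  -- The first digit leaves no `half` mark, so that `k - 1` of them remain.
  | .readK₀ => pop .inp (fun r o => { r with inp := o }) <| branch (fun r => isBit r.inp)
      (push .cnt (fun _ => .keep) <| jump .readK) (jump .readQ)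
  | .readK => pop .inp (fun r o => { r with inp := o }) <| branch (fun r => isBit r.inp)
      (push .cnt (fun _ => .keep) <| push .q (fun _ => .half) <| jump .readK) (jump .readQ)
  | .readQ => pop .inp (fun r o => { r with inp := o }) <| branch (fun r => isBit r.inp)
      (push .q (fun _ => .double) <| jump .readQ) (jump .readL)
  | .readL => pop .inp (fun r o => { r with inp := o }) <| branch (fun r => isBit r.inp)
      (push .q (fun _ => .keep) <| jump .readL) (jump .flip)
  | .flip => pop .q (fun r o => { r with mark := o }) <| branch (fun r => r.mark.isSome)
      (push .r (fun r => r.mark.getD .keep) <| jump .flip) (jump .level)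
  | .level => peek .r (fun r o => { r with mark := o }) <|
      branch (fun r => match r.mark with | some .half => true | _ => false)
      (push .ctl (fun _ => .level false) <| jump .expand) (jump .clearR)
  | .expand => pop .r (fun r o => { r with mark := o }) <| branch (fun r => r.mark.isSome)
      -- Each mark stands for 34 walk steps of four bits each.
      (pushMany .ctl .pull 136 <|
        branch (fun r => match r.mark with | some .half => true | _ => false)
          (branch (fun r => r.flag) (push .q (fun _ => .half) <| jump .expand)
            (load (fun _ => { flag := true }) (goto fun _ => .expand)))
          (push .q (fun r => r.mark.getD .keep) <|
            branch (fun r => match r.mark with | some .double => true | _ => false)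
              (push .q (fun _ => .double) <| jump .expand) (jump .expand)))
      (jump .flip)
  | .clearR => pop .r (fun r o => { r with mark := o }) <| branch (fun r => r.mark.isSome)
      (jump .clearR) (jump .readX)
  | .readX => pop .inp (fun r o => { r with inp := o }) <| branch (fun r => isBit r.inp)
      (push .ctl (fun r => .seed (bitOf r.inp)) <| jump .readX) (jump .next)
  | .next => pop .cnt (fun r o => { r with mark := o }) <| branch (fun r => r.mark.isSome)
      (jump .run) (jump .write)
  | .run => pop .ctl (fun r o => { r with ins := o }) <| branch (fun r => r.ins.isSome)
      (push .done (fun r => r.ins.getD .emit) <|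
        branch (fun r => match r.ins with | some (.seed _) => true | _ => false)
          (push .cur (fun r => match r.ins with | some (.seed b) => b | _ => false) <| jump .run) <|
        branch (fun r => match r.ins with | some (.level _) => true | _ => false)
          (branch (fun r => match r.ins with | some (.level b) => b | _ => false)
            (jump .walk) (jump .clearDir)) <|
        pop .cur (fun r o => { r with y := o }) <|
        branch (fun r => match r.ins with | some .pull => true | _ => false)
          (push .dir (fun r => r.y.getD false) <| jump .run)
          (push .res (fun r => r.y.getD false) <| jump .run))
      (load (fun _ => { flag := true }) (goto fun _ => .rewind))
  | .clearDir => pop .dir (fun r o => { r with y := o }) <| branch (fun r => r.y.isSome)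
      (jump .clearDir) (jump .run)
  | .walk => pop .dir (fun r o => { r with y := o }) <| branch (fun r => r.y.isSome)
      (pop .dir (fun r o => { r with b := o.getD false }) <|
        pop .dir (fun r o => { r with flag := o.getD false }) <|
        pop .dir (fun r o => { r with c := o.getD false }) <|
        pop .cur (fun r _ => r) <| pop .cur (fun r _ => r) <|
        push .cur (fun r => r.b) <| push .cur (fun r => r.y.getD false) <|
        load (fun r => { flag := r.flag, c := r.c }) (goto fun _ => .pass))
      (jump .run)
  | .pass => pop .cur (fun r o => { r with y := o }) <| branch (fun r => r.y.isSome)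
      (pop .cur (fun r o => { r with y' := o }) <|
        push .tmp (fun r => r.y.getD false ^^ (r.flag && (mulF r.c r.w).1)) <|
        branch (fun r => r.y'.isSome)
          (push .tmp (fun r => r.y'.getD false ^^ (r.flag && (mulF r.c r.w).2)) <|
            load (fun r => { flag := !r.flag, c := r.c, w := (r.y.getD false, r.y'.getD false) })
              (goto fun _ => .pass))
          (jump .back))
      (jump .back)
  | .back => pop .tmp (fun r o => { r with y := o }) <| branch (fun r => r.y.isSome)
      (push .cur (fun r => r.y.getD false) <| jump .back) (jump .walk)
  | .rewind => pop .done (fun r o => { r with ins := o }) <| branch (fun r => r.ins.isSome)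
      (push .ctl (fun r => match r.ins with
          | some (.level b) => .level (b ^^ r.flag) | o => o.getD .emit) <|
        load (fun r => { flag := match r.ins with | some (.level b) => b && r.flag | _ => r.flag })
          (goto fun _ => .rewind))
      (jump .clearCur)
  | .clearCur => pop .cur (fun r o => { r with y := o }) <| branch (fun r => r.y.isSome)
      (jump .clearCur) (jump .next)
  | .write => pop .res (fun r o => { r with y := o }) <| branch (fun r => r.y.isSome)
      (push .out (fun r => r.y.getD false) <| jump .write) (jump .clearCtl)
  | .clearCtl => pop .ctl (fun r o => { r with ins := o }) <| branch (fun r => r.ins.isSome)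
      (jump .clearCtl) (load (fun _ => {}) halt)

/-- The machine that computes the generator. -/
noncomputable def machine : Turing.TM2ComputableAux (Option Bool) Bool where
  tm :=
    { K := Stack
      k₀ := .inp
      k₁ := .out
      Γ := Stack.Alphabet
      Λ := Label
      main := .readN
      σ := Reg
      initialState := {}
      Γk₀Fin := inferInstanceAs (Fintype (Option Bool))
      m := prog }
  inputAlphabet := Equiv.refl _
  outputAlphabet := Equiv.refl _

/-- The contents of the stacks. -/
structure Mem where
  inp : List (Option Bool) := []
  out : List Bool := []
  ctl : List Instr := []
  done : List Instr := []
  cur : List Bool := []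
  dir : List Bool := []
  tmp : List Bool := []
  res : List Bool := []
  cnt : List Mark := []
  q : List Mark := []
  r : List Mark := []

/-- The stacks as a function. -/
def Mem.stk (S : Mem) : ∀ k : Stack, List k.Alphabet
  | .inp => S.inp
  | .out => S.out
  | .ctl => S.ctl
  | .done => S.done
  | .cur => S.cur
  | .dir => S.dir
  | .tmp => S.tmp
  | .res => S.res
  | .cnt => S.cnt
  | .q => S.q
  | .r => S.r

/-- Configurations of the machine. -/
abbrev Config := Turing.TM2.Cfg Stack.Alphabet Label Reg

/-- The configuration with given label, registers and stacks. -/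
def cfg (l : Label) (v : Reg) (S : Mem) : Config := ⟨some l, v, S.stk⟩

section
variable (S : Mem)
theorem upd_inp (l) : Function.update S.stk .inp l = Mem.stk { S with inp := l } := by
  funext k; cases k <;> rfl
theorem upd_out (l) : Function.update S.stk .out l = Mem.stk { S with out := l } := by
  funext k; cases k <;> rfl
theorem upd_ctl (l) : Function.update S.stk .ctl l = Mem.stk { S with ctl := l } := by
  funext k; cases k <;> rfl
theorem upd_done (l) : Function.update S.stk .done l = Mem.stk { S with done := l } := by
  funext k; cases k <;> rfl
theorem upd_cur (l) : Function.update S.stk .cur l = Mem.stk { S with cur := l } := by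
  funext k; cases k <;> rfl
theorem upd_dir (l) : Function.update S.stk .dir l = Mem.stk { S with dir := l } := by
  funext k; cases k <;> rfl
theorem upd_tmp (l) : Function.update S.stk .tmp l = Mem.stk { S with tmp := l } := by
  funext k; cases k <;> rfl
theorem upd_res (l) : Function.update S.stk .res l = Mem.stk { S with res := l } := by
  funext k; cases k <;> rfl
theorem upd_cnt (l) : Function.update S.stk .cnt l = Mem.stk { S with cnt := l } := by
  funext k; cases k <;> rfl
theorem upd_q (l) : Function.update S.stk .q l = Mem.stk { S with q := l } := by
  funext k; cases k <;> rfl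
theorem upd_r (l) : Function.update S.stk .r l = Mem.stk { S with r := l } := by
  funext k; cases k <;> rfl
end

/-! ### Timed reachability between configurations -/

/-- `c'` is reached from `c` in at most `t` steps. -/
def Reach (t : ℕ) (c c' : Config) : Prop :=
  ∃ j ≤ t, (flip bind (Turing.TM2.step prog))^[j] (some c) = some c'

theorem Reach.refl (c : Config) : Reach 0 c c := ⟨0, le_rfl, rfl⟩

theorem Reach.single {c c' : Config} (h : Turing.TM2.step prog c = some c') : Reach 1 c c' :=
  ⟨1, le_rfl, h⟩

theorem Reach.trans {s t : ℕ} {a b c : Config} (h : Reach s a b) (h' : Reach t b c) :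
    Reach (s + t) a c := by
  obtain ⟨i, hi, e⟩ := h
  obtain ⟨j, hj, e'⟩ := h'
  exact ⟨j + i, by omega, by rw [Function.iterate_add_apply, e, e']⟩

theorem Reach.mono {s t : ℕ} {a b : Config} (h : Reach s a b) (hst : s ≤ t) : Reach t a b := by
  obtain ⟨i, hi, e⟩ := h
  exact ⟨i, hi.trans hst, e⟩

theorem stepAux_pushMany (a : Instr) (m : ℕ) (s : Turing.TM2.Stmt Stack.Alphabet Label Reg) (v : Reg)
    (S : Mem) : Turing.TM2.stepAux (pushMany .ctl a m s) v S.stk =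
      Turing.TM2.stepAux s v (Mem.stk { S with ctl := List.replicate m a ++ S.ctl }) := by
  induction m generalizing S with
  | zero => rfl
  | succ m ih =>
    simp only [pushMany, Turing.TM2.stepAux, upd_ctl]
    rw [ih]
    simp [List.replicate_succ']
    rfl

attribute [local simp] cfg prog jump isBit bitOf Mem.stk upd_inp upd_out upd_ctl upd_done upd_cur
  upd_dir upd_tmp upd_res upd_cnt upd_q upd_r

theorem replicate_append_cons {α : Type*} (n : ℕ) (a : α) (l : List α) :
    List.replicate n a ++ a :: l = List.replicate (n + 1) a ++ l := by
  rw [List.replicate_succ', List.append_assoc]; rfl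

theorem reverse_append_cons {α : Type*} (l : List α) (a : α) (l' : List α) :
    l.reverse ++ a :: l' = (a :: l).reverse ++ l' := by simp

theorem Reach.cons {t : ℕ} {a b c : Config} (h : Turing.TM2.step prog a = some b)
    (h' : Reach t b c) : Reach (t + 1) a c := by
  rw [Nat.add_comm]; exact (Reach.single h).trans h'

/-! ### Reading the input -/

theorem reach_readN (n : ℕ) (w : List (Option Bool)) (l : List Instr) (S : Mem) :
    Reach (n + 1)
      (cfg .readN {} { S with inp := List.replicate n (some true) ++ none :: w, ctl := l })
      (cfg .readK₀ {} { S with inp := w, ctl := List.replicate n .emit ++ l }) := by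
  induction n generalizing l with
  | zero => exact Reach.single (by simp)
  | succ n ih =>
    exact Reach.cons (by simp [List.replicate_succ])
      (replicate_append_cons n Instr.emit l ▸ ih (.emit :: l))

theorem reach_readK (k : ℕ) (w : List (Option Bool)) (l l' : List Mark) (S : Mem) :
    Reach (k + 1)
      (cfg .readK {} { S with inp := List.replicate k (some true) ++ none :: w, cnt := l, q := l' })
      (cfg .readQ {} { S with
        inp := w, cnt := List.replicate k .keep ++ l, q := List.replicate k .half ++ l' }) := by
  induction k generalizing l l' with
  | zero => exact Reach.single (by simp)
  | succ n ih =>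
    exact Reach.cons (by simp [List.replicate_succ])
      (replicate_append_cons n Mark.keep l ▸ replicate_append_cons n Mark.half l' ▸
        ih (.keep :: l) (.half :: l'))

theorem reach_readK₀ (k : ℕ) (w : List (Option Bool)) (S : Mem) :
    Reach (k + 1)
      (cfg .readK₀ {} { S with inp := List.replicate k (some true) ++ none :: w, cnt := [], q := [] })
      (cfg .readQ {} { S with
        inp := w, cnt := List.replicate k .keep, q := List.replicate (k - 1) .half }) := by
  cases k with
  | zero => exact Reach.single (by simp)
  | succ k =>
    have h := reach_readK k w [.keep] [] S
    rw [replicate_append_cons, List.append_nil, List.append_nil] at h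
    exact Reach.cons (by simp [List.replicate_succ]) h

theorem reach_readQ (q : List Bool) (w : List (Option Bool)) (l : List Mark) (S : Mem) :
    Reach (q.length + 1) (cfg .readQ {} { S with inp := q.map some ++ none :: w, q := l })
      (cfg .readL {} { S with inp := w, q := List.replicate q.length .double ++ l }) := by
  induction q generalizing l with
  | nil => exact Reach.single (by simp)
  | cons b q ih =>
    exact Reach.cons (by simp)
      (replicate_append_cons q.length Mark.double l ▸ ih (.double :: l))

theorem reach_readL (n : ℕ) (w : List (Option Bool)) (l : List Mark) (S : Mem) :
    Reach (n + 1)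
      (cfg .readL {} { S with inp := List.replicate n (some true) ++ none :: w, q := l })
      (cfg .flip {} { S with inp := w, q := List.replicate n .keep ++ l }) := by
  induction n generalizing l with
  | zero => exact Reach.single (by simp)
  | succ n ih =>
    exact Reach.cons (by simp [List.replicate_succ])
      (replicate_append_cons n Mark.keep l ▸ ih (.keep :: l))

theorem reach_readX (x : List Bool) (l : List Instr) (S : Mem) :
    Reach (x.length + 1) (cfg .readX {} { S with inp := x.map some, ctl := l })
      (cfg .next {} { S with inp := [], ctl := (x.map .seed).reverse ++ l }) := by
  induction x generalizing l with
  | nil => exact Reach.single (by simp)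
  | cons b x ih =>
    exact Reach.cons (by simp)
      (reverse_append_cons (x.map Instr.seed) (Instr.seed b) l ▸ ih (.seed b :: l))

/-! ### Preparing the control stack -/

theorem reach_flip (l l' : List Mark) (S : Mem) :
    Reach (l.length + 1) (cfg .flip {} { S with q := l, r := l' })
      (cfg .level {} { S with q := [], r := l.reverse ++ l' }) := by
  induction l generalizing l' with
  | nil => exact Reach.single (by simp)
  | cons b x ih => exact Reach.cons (by simp) (reverse_append_cons x b l' ▸ ih (b :: l'))

theorem reach_clearR (l : List Mark) (S : Mem) :
    Reach (l.length + 1) (cfg .clearR {} { S with r := l }) (cfg .readX {} { S with r := [] }) := by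
  induction l with
  | nil => exact Reach.single (by simp)
  | cons b x ih => exact Reach.cons (by simp) ih

/-- The flag is the parity of the marks seen, and only every second one is copied. Its final value
is irrelevant, because the other kinds of marks ignore it. -/
theorem reach_expand_half (h : ℕ) (f : Bool) (R Q : List Mark) (l : List Instr) (S : Mem) :
    ∃ f', Reach h
      (cfg .expand { flag := f } { S with r := List.replicate h .half ++ R, q := Q, ctl := l })
      (cfg .expand { flag := f' } { S with
        r := R, q := List.replicate ((h + f.toNat) / 2) .half ++ Q,
        ctl := List.replicate (136 * h) .pull ++ l }) := by
  induction h generalizing f Q l with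
  | zero => exact ⟨f, by cases f <;> exact Reach.refl _⟩
  | succ h ih =>
    have e : List.replicate (136 * h) Instr.pull ++ (List.replicate 136 .pull ++ l) =
        List.replicate (136 * (h + 1)) .pull ++ l := by
      rw [← List.append_assoc, List.replicate_append_replicate]; congr
    cases f with
    | false =>
      obtain ⟨f', h'⟩ := ih true Q (List.replicate 136 .pull ++ l)
      refine ⟨f', Reach.cons ?_ (by rw [e] at h'; exact h')⟩
      simp [List.replicate_succ, stepAux_pushMany]
    | true =>
      obtain ⟨f', h'⟩ := ih false (.half :: Q) (List.replicate 136 .pull ++ l)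
      refine ⟨f', Reach.cons ?_ (by
        rw [e, replicate_append_cons] at h'
        convert h' using 5
        simp; omega)⟩
      simp [List.replicate_succ, stepAux_pushMany]

theorem reach_expand_double (h : ℕ) (f : Bool) (R Q : List Mark) (l : List Instr) (S : Mem) :
    ∃ f', Reach h
      (cfg .expand { flag := f } { S with r := List.replicate h .double ++ R, q := Q, ctl := l })
      (cfg .expand { flag := f' } { S with
        r := R, q := List.replicate (h * 2) .double ++ Q,
        ctl := List.replicate (136 * h) .pull ++ l }) := by
  induction h generalizing f Q l with
  | zero => exact ⟨f, Reach.refl _⟩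
  | succ h ih =>
    have e : List.replicate (136 * h) Instr.pull ++ (List.replicate 136 .pull ++ l) =
        List.replicate (136 * (h + 1)) .pull ++ l := by
      rw [← List.append_assoc, List.replicate_append_replicate]; congr
    obtain ⟨f', h'⟩ := ih false (.double :: .double :: Q) (List.replicate 136 .pull ++ l)
    refine ⟨f', Reach.cons ?_ (by
      rw [e, replicate_append_cons, replicate_append_cons] at h'
      convert h' using 5
      ring)⟩
    simp [List.replicate_succ, stepAux_pushMany]

theorem reach_expand_keep (h : ℕ) (f : Bool) (R Q : List Mark) (l : List Instr) (S : Mem) :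
    ∃ f', Reach h
      (cfg .expand { flag := f } { S with r := List.replicate h .keep ++ R, q := Q, ctl := l })
      (cfg .expand { flag := f' } { S with
        r := R, q := List.replicate h .keep ++ Q,
        ctl := List.replicate (136 * h) .pull ++ l }) := by
  induction h generalizing f Q l with
  | zero => exact ⟨f, Reach.refl _⟩
  | succ h ih =>
    have e : List.replicate (136 * h) Instr.pull ++ (List.replicate 136 .pull ++ l) =
        List.replicate (136 * (h + 1)) .pull ++ l := by
      rw [← List.append_assoc, List.replicate_append_replicate]; congr
    obtain ⟨f', h'⟩ := ih false (.keep :: Q) (List.replicate 136 .pull ++ l)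
    refine ⟨f', Reach.cons ?_ (by
      rw [e, replicate_append_cons] at h'
      exact h')⟩
    simp [List.replicate_succ, stepAux_pushMany]

/-- The contents of the stack `r` before a level is written. -/
def marks (h p l : ℕ) : List Mark :=
  List.replicate h .half ++ (List.replicate p .double ++ List.replicate l .keep)

theorem reach_expand (h p l : ℕ) (L : List Instr) (S : Mem) :
    Reach (2 * h + 3 * p + 2 * l + 5)
      (cfg .level {} { S with r := marks (h + 1) p l, q := [], ctl := L })
      (cfg .level {} { S with
        r := marks ((h + 1) / 2) (p * 2) l, q := [],
        ctl := List.replicate (136 * (h + 1 + p + l)) .pull ++ .level false :: L }) := by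
  have s0 : Reach 1 (cfg .level {} { S with r := marks (h + 1) p l, q := [], ctl := L })
      (cfg .expand {} { S with r := marks (h + 1) p l, q := [], ctl := .level false :: L }) :=
    Reach.single (by simp [marks, List.replicate_succ])
  obtain ⟨f₁, s1⟩ := reach_expand_half (h + 1) false
    (List.replicate p .double ++ List.replicate l .keep) [] (.level false :: L) S
  obtain ⟨f₂, s2⟩ := reach_expand_double p f₁ (List.replicate l .keep)
    (List.replicate ((h + 1) / 2) .half)
    (List.replicate (136 * (h + 1)) .pull ++ .level false :: L) S
  obtain ⟨f₃, s3⟩ := reach_expand_keep l f₂ []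
    (List.replicate (p * 2) .double ++ List.replicate ((h + 1) / 2) .half)
    (List.replicate (136 * p) .pull ++
      (List.replicate (136 * (h + 1)) .pull ++ .level false :: L)) S
  have e : List.replicate (136 * l) Instr.pull ++ (List.replicate (136 * p) .pull ++
      (List.replicate (136 * (h + 1)) .pull ++ .level false :: L)) =
      List.replicate (136 * (h + 1 + p + l)) .pull ++ .level false :: L := by
    simp only [← List.append_assoc, List.replicate_append_replicate]
    congr 2; ring
  rw [e] at s3
  have s4 := reach_flip (List.replicate l .keep ++
    (List.replicate (p * 2) .double ++ List.replicate ((h + 1) / 2) .half)) []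
    { S with ctl := List.replicate (136 * (h + 1 + p + l)) .pull ++ .level false :: L }
  have s5 : Reach 1 (cfg .expand { flag := f₃ } { S with
      r := [], q := List.replicate l .keep ++
        (List.replicate (p * 2) .double ++ List.replicate ((h + 1) / 2) .half)
      ctl := List.replicate (136 * (h + 1 + p + l)) .pull ++ .level false :: L })
      (cfg .flip {} { S with
        r := [], q := List.replicate l .keep ++
          (List.replicate (p * 2) .double ++ List.replicate ((h + 1) / 2) .half)
        ctl := List.replicate (136 * (h + 1 + p + l)) .pull ++ .level false :: L }) :=
    Reach.single (by simp)
  simp only [List.reverse_append, List.reverse_replicate, List.append_nil, List.append_assoc] at s4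
  simp only [List.append_nil, Bool.toNat_false, add_zero] at s1 s3
  refine Reach.mono (s0.trans <| s1.trans <| s2.trans <| s3.trans <| s5.trans s4) ?_
  simp only [List.length_append, List.length_replicate]
  omega

/-- The part of the control stack that generates the `j`-th of `2 ^ i` blocks from the seed. -/
def tape (n : ℕ) (t : ℕ → ℕ) : ℕ → ℕ → List Instr
  | 0, _ => List.replicate n .emit
  | i + 1, j => List.replicate (4 * t i) .pull ++ .level (j.testBit i) :: tape n t i j

/-- The numbers of steps of the walks. -/
def steps (h p l i : ℕ) : ℕ := 34 * (h / 2 ^ i + p * 2 ^ i + l)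

/-- Halving serves twice: the `half` marks give the term `h / 2 ^ i` of the walk length, and they
run out after exactly `h.size` levels, which ends the loop. -/
theorem reach_levels (n h p l i : ℕ) (hi : i ≤ h.size) (S : Mem) :
    Reach (i * (2 * h + 3 * (p * h) + 2 * l + 5))
      (cfg .level {} { S with r := marks h p l, q := [], ctl := List.replicate n .emit })
      (cfg .level {} { S with
        r := marks (h / 2 ^ i) (p * 2 ^ i) l, q := [], ctl := tape n (steps h p l) i 0 }) := by
  induction i with
  | zero => simpa [tape] using Reach.refl _
  | succ i ih =>
    have hle : 2 ^ i ≤ h := Nat.lt_size.mp (by omega)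
    obtain ⟨m, hm⟩ : ∃ m, h / 2 ^ i = m + 1 :=
      Nat.exists_eq_add_one.mpr (Nat.div_pos hle (by positivity))
    have s := reach_expand m (p * 2 ^ i) l (tape n (steps h p l) i 0) S
    have e1 : (m + 1) / 2 = h / 2 ^ (i + 1) := by rw [← hm, Nat.div_div_eq_div_mul, pow_succ]
    have e2 : List.replicate (136 * (m + 1 + p * 2 ^ i + l)) Instr.pull ++
        .level false :: tape n (steps h p l) i 0 = tape n (steps h p l) (i + 1) 0 := by
      simp only [tape, steps, hm, Nat.zero_testBit]
      congr 2; ring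
    rw [e1, e2, ← hm, mul_assoc, ← pow_succ] at s
    refine ((ih (by omega)).trans s).mono ?_
    have : m + 1 ≤ h := hm ▸ Nat.div_le_self _ _
    have : p * 2 ^ i ≤ p * h := Nat.mul_le_mul_left _ hle
    rw [Nat.succ_mul i]
    omega

theorem reach_setup (n k : ℕ) (q : List Bool) (l : ℕ) (x : List Bool) :
    Reach (n + k + q.length + l + 4 +
        (k + q.length + l + (k - 1).size * (2 * k + 3 * (q.length * k) + 2 * l + 5) +
          2 * (q.length * k) + q.length + l + x.length + 4))
      (cfg .readN {} { inp := List.replicate n (some true) ++ none ::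
        (List.replicate k (some true) ++ none :: (q.map some ++ none ::
          (List.replicate l (some true) ++ none :: x.map some))) })
      (cfg .next {} {
        cnt := List.replicate k .keep,
        ctl := (x.map .seed).reverse ++
          tape n (steps (k - 1) q.length l) (k - 1).size 0 }) := by
  have s1 := reach_readN n (List.replicate k (some true) ++ none :: (q.map some ++ none ::
          (List.replicate l (some true) ++ none :: x.map some))) [] {}
  have s2 := reach_readK₀ k (q.map some ++ none ::
          (List.replicate l (some true) ++ none :: x.map some)) { ctl := List.replicate n .emit }
  have s3 := reach_readQ q (List.replicate l (some true) ++ none :: x.map some)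
    (List.replicate (k - 1) .half)
    { ctl := List.replicate n .emit, cnt := List.replicate k .keep }
  have s4 := reach_readL l (x.map some)
    (List.replicate q.length .double ++ List.replicate (k - 1) .half)
    { ctl := List.replicate n .emit, cnt := List.replicate k .keep }
  have s5 := reach_flip (List.replicate l .keep ++
      (List.replicate q.length .double ++ List.replicate (k - 1) .half)) []
    { inp := x.map some, ctl := List.replicate n .emit, cnt := List.replicate k .keep }
  have s6 := reach_levels n (k - 1) q.length l (k - 1).size le_rfl
    { inp := x.map some, cnt := List.replicate k .keep }
  have h0 : (k - 1) / 2 ^ (k - 1).size = 0 := Nat.div_eq_of_lt (Nat.lt_size_self _)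
  set T := tape n (steps (k - 1) q.length l) (k - 1).size 0
  set P := q.length * 2 ^ (k - 1).size with hP
  have s7 : Reach 1 (cfg .level {} {
        inp := x.map some, cnt := List.replicate k .keep, r := marks 0 P l, ctl := T })
      (cfg .clearR {} {
        inp := x.map some, cnt := List.replicate k .keep, r := marks 0 P l, ctl := T }) := by
    refine Reach.single ?_
    cases P <;> cases l <;> simp [marks, List.replicate_succ]
  have s8 := reach_clearR (marks 0 P l)
    { inp := x.map some, cnt := List.replicate k .keep, ctl := T }
  have s9 := reach_readX x T { cnt := List.replicate k .keep }
  rw [List.append_nil] at s1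
  simp only [List.reverse_append, List.reverse_replicate, List.append_nil, List.append_assoc] at s5
  rw [h0] at s6
  refine Reach.mono (s1.trans <| s2.trans <| s3.trans <| s4.trans <| s5.trans <| s6.trans <|
    s7.trans <| s8.trans s9) ?_
  simp only [marks, List.length_append, List.length_replicate]
  have hP' : P ≤ 2 * (q.length * k) + q.length := by
    rcases Nat.eq_zero_or_pos (k - 1) with h | h
    · rw [hP, h]; simp
    · have : 2 ^ ((k - 1).size - 1) ≤ k - 1 :=
        Nat.lt_size.mp (Nat.sub_lt (Nat.size_pos.mpr h) one_pos)
      have h2 : 2 ^ (k - 1).size = 2 * 2 ^ ((k - 1).size - 1) := by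
        rw [← pow_succ', Nat.sub_add_cancel (Nat.size_pos.mpr h)]
      have h3 : q.length * 2 ^ (k - 1).size ≤ q.length * (2 * k) := Nat.mul_le_mul_left _ (by omega)
      rw [hP]
      calc _ ≤ q.length * (2 * k) := h3
        _ = 2 * (q.length * k) := by ring
        _ ≤ _ := by omega
  have hk : q.length * (k - 1) ≤ q.length * k := Nat.mul_le_mul_left _ (by omega)
  have hm : (k - 1).size * (2 * (k - 1) + 3 * (q.length * (k - 1)) + 2 * l + 5) ≤
      (k - 1).size * (2 * k + 3 * (q.length * k) + 2 * l + 5) := Nat.mul_le_mul_left _ (by omega)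
  omega

/-! ### Running the control stack -/

theorem reach_run_seed (x : List Bool) (L D : List Instr) (z : List Bool) (S : Mem) :
    Reach x.length (cfg .run {} { S with ctl := x.map .seed ++ L, done := D, cur := z })
      (cfg .run {} { S with ctl := L, done := (x.map .seed).reverse ++ D, cur := x.reverse ++ z }) := by
  induction x generalizing D z with
  | nil => exact Reach.refl _
  | cons b x ih =>
    exact Reach.cons (by simp) (reverse_append_cons (x.map Instr.seed) (Instr.seed b) D ▸
      reverse_append_cons x b z ▸ ih (.seed b :: D) (b :: z))

theorem reach_run_pull (a : ℕ) (L D : List Instr) (z y : List Bool) (S : Mem) :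
    Reach a
      (cfg .run {} { S with ctl := List.replicate a .pull ++ L, done := D, cur := z, dir := y })
      (cfg .run {} { S with
        ctl := L, done := List.replicate a .pull ++ D, cur := (pull a z y).1,
        dir := (pull a z y).2 }) := by
  induction a generalizing D z y with
  | zero => exact Reach.refl _
  | succ a ih =>
    exact Reach.cons (by cases z <;> simp [List.replicate_succ])
      (replicate_append_cons a Instr.pull D ▸ ih (.pull :: D) z.tail (z.headD false :: y))

theorem reach_run_emit (a : ℕ) (L D : List Instr) (z o : List Bool) (S : Mem) :
    Reach a
      (cfg .run {} { S with ctl := List.replicate a .emit ++ L, done := D, cur := z, res := o })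
      (cfg .run {} { S with
        ctl := L, done := List.replicate a .emit ++ D, cur := z.drop a,
        res := (emit a z).reverse ++ o }) := by
  induction a generalizing D z o with
  | zero => exact Reach.refl _
  | succ a ih =>
    have h := ih (.emit :: D) z.tail (z.headD false :: o)
    rw [replicate_append_cons, reverse_append_cons, List.drop_tail] at h
    exact Reach.cons (by cases z <;> simp [List.replicate_succ]) h

theorem reach_clearDir (y : List Bool) (S : Mem) :
    Reach (y.length + 1) (cfg .clearDir {} { S with dir := y }) (cfg .run {} { S with dir := [] }) := by
  induction y with
  | nil => exact Reach.single (by simp)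
  | cons b x ih => exact Reach.cons (by simp) ih

theorem reach_clearCur (y : List Bool) (S : Mem) :
    Reach (y.length + 1) (cfg .clearCur {} { S with cur := y })
      (cfg .next {} { S with cur := [] }) := by
  induction y with
  | nil => exact Reach.single (by simp)
  | cons b x ih => exact Reach.cons (by simp) ih

theorem reach_write (y o : List Bool) (S : Mem) :
    Reach (y.length + 1) (cfg .write {} { S with res := y, out := o })
      (cfg .clearCtl {} { S with res := [], out := y.reverse ++ o }) := by
  induction y generalizing o with
  | nil => exact Reach.single (by simp)
  | cons b x ih => exact Reach.cons (by simp) (reverse_append_cons x b o ▸ ih (b :: o))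

theorem reach_clearCtl (L : List Instr) (S : Mem) :
    Reach (L.length + 1) (cfg .clearCtl {} { S with ctl := L })
      ⟨none, {}, Mem.stk { S with ctl := [] }⟩ := by
  induction L with
  | nil => exact Reach.single (by simp)
  | cons b x ih => exact Reach.cons (by simp) ih

theorem reach_back (y z : List Bool) (S : Mem) :
    Reach (y.length + 1) (cfg .back {} { S with tmp := y, cur := z })
      (cfg .walk {} { S with tmp := [], cur := y.reverse ++ z }) := by
  induction y generalizing z with
  | nil => exact Reach.single (by simp)
  | cons b x ih => exact Reach.cons (by simp) (reverse_append_cons x b z ▸ ih (b :: z))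

theorem reach_pass (c π : Bool) (w : Bool × Bool) (z o : List Bool) (S : Mem) :
    Reach (z.length + 1) (cfg .pass { flag := π, c := c, w := w } { S with cur := z, tmp := o })
      (cfg .back {} { S with cur := [], tmp := (shear c π w z).reverse ++ o }) := by
  fun_induction shear c π w z generalizing o with
  | case1 => exact Reach.single (by simp)
  | case2 => exact (Reach.single (by simp)).mono (by simp)
  | case3 π w a b r ih =>
    have h := ih ((b ^^ (π && (mulF c w).2)) :: (a ^^ (π && (mulF c w).1)) :: o)
    rw [reverse_append_cons, reverse_append_cons] at h
    exact (Reach.cons (by simp) h).mono (by simp)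

/-- A walk step takes one step to overwrite the first pair, at most `M + 1` to shear the word onto
`tmp` and `M + 1` to move it back. A shorter word is lengthened to two bits by the overwriting,
hence `2 ≤ M`. -/
theorem reach_walk (t M : ℕ) (Y z : List Bool) (hY : Y.length = 4 * t) (hM : 2 ≤ M)
    (hz : z.length ≤ M) (S : Mem) :
    Reach (t * (2 * M + 3) + 1) (cfg .walk {} { S with dir := Y, cur := z, tmp := [] })
      (cfg .run {} { S with dir := [], cur := walk Y z, tmp := [] }) := by
  induction t generalizing Y z with
  | zero =>
    obtain rfl : Y = [] := by simpa using hY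
    exact (Reach.single (by simp [walk])).mono (by simp)
  | succ t ih =>
    match Y, hY with
    | a :: b :: π :: c :: Y, hY =>
      have hz' : (expStep a b π c z).length ≤ M := by
        simp [expStep, shear_length]; omega
      have s1 : Reach 1 (cfg .walk {} { S with dir := a :: b :: π :: c :: Y, cur := z, tmp := [] })
          (cfg .pass { flag := π, c := c, w := (false, false) }
            { S with dir := Y, cur := a :: b :: z.drop 2, tmp := [] }) :=
        Reach.single (by rcases z with _ | ⟨_, _ | ⟨_, _⟩⟩ <;> simp)
      have s2 := reach_pass c π (false, false) (a :: b :: z.drop 2) [] { S with dir := Y }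
      have s3 := reach_back (expStep a b π c z).reverse [] { S with dir := Y }
      have s4 := ih Y (expStep a b π c z) (by simp at hY; omega) hz'
      rw [List.append_nil] at s2 s3
      rw [List.reverse_reverse] at s3
      refine (s1.trans <| s2.trans <| s3.trans s4).mono ?_
      rw [List.length_reverse]
      have : (a :: b :: z.drop 2).length ≤ M := by simp; omega
      rw [Nat.succ_mul t]
      omega

theorem pull_length (a : ℕ) (z y : List Bool) :
    (pull a z y).1.length ≤ z.length ∧ (pull a z y).2.length = y.length + a := by
  induction a generalizing z y with
  | zero => simp [pull]
  | succ a ih =>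
    have := ih z.tail (z.headD false :: y)
    simp only [pull, List.length_tail, List.length_cons] at this ⊢
    omega

theorem walk_length_le (M : ℕ) (hM : 2 ≤ M) (Y z : List Bool) (h : z.length ≤ M) :
    (walk Y z).length ≤ M := by
  fun_induction walk Y z with
  | case1 a b π c Y z ih =>
    refine ih ?_
    simp [expStep, shear_length]; omega
  | case2 => exact h

/-- A bound for the time to run the control stack once. -/
def runTime (n : ℕ) (t : ℕ → ℕ) (M : ℕ) : ℕ → ℕ
  | 0 => n
  | i + 1 => t i * (2 * M + 7) + 2 + runTime n t M i

/-- Of the leftover word `z'` only the length matters, since it is erased before the next block. -/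
theorem reach_run_tape (n : ℕ) (t : ℕ → ℕ) (M : ℕ) (hM : 2 ≤ M) (i j : ℕ) (L D : List Instr)
    (z o : List Bool) (hz : z.length ≤ M) (S : Mem) : ∃ z' : List Bool, z'.length ≤ M ∧
    Reach (runTime n t M i)
      (cfg .run {} { S with
        ctl := tape n t i j ++ L, done := D, cur := z, res := o, dir := [], tmp := [] })
      (cfg .run {} { S with
        ctl := L, done := (tape n t i j).reverse ++ D, cur := z',
        res := (block n t i j z).reverse ++ o, dir := [], tmp := [] }) := by
  induction i generalizing D z with
  | zero =>
    have := reach_run_emit n L D z o { S with dir := [], tmp := [] }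
    refine ⟨z.drop n, by simp; omega, ?_⟩
    simpa only [tape, block, runTime, List.reverse_replicate] using this
  | succ i ih =>
    set p := pull (4 * t i) z [] with hp
    have hp1 : p.1.length ≤ M := (pull_length _ _ _).1.trans hz
    have hp2 : p.2.length = 4 * t i := by simpa using (pull_length (4 * t i) z []).2
    have s1 := reach_run_pull (4 * t i) (.level (j.testBit i) :: (tape n t i j ++ L)) D z []
      { S with res := o, tmp := [] }
    rw [← hp] at s1
    have e1 : tape n t (i + 1) j ++ L =
        List.replicate (4 * t i) .pull ++ .level (j.testBit i) :: (tape n t i j ++ L) := by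
      simp [tape]
    have e2 : (tape n t (i + 1) j).reverse ++ D = (tape n t i j).reverse ++
        .level (j.testBit i) :: (List.replicate (4 * t i) .pull ++ D) := by
      simp [tape]
    rw [e1, e2]
    set D' := Instr.level (j.testBit i) :: (List.replicate (4 * t i) .pull ++ D) with hD'
    set z₁ := if j.testBit i then walk p.2 p.1 else p.1 with hz₁
    have hz₁l : z₁.length ≤ M := by
      rw [hz₁]; split_ifs
      · exact walk_length_le M hM _ _ hp1
      · exact hp1
    obtain ⟨z', hz', s3⟩ := ih D' z₁ hz₁l
    refine ⟨z', hz', ?_⟩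
    have s2 : Reach (t i * (2 * M + 3) + 2)
        (cfg .run {} { S with
          ctl := .level (j.testBit i) :: (tape n t i j ++ L),
          done := List.replicate (4 * t i) .pull ++ D, cur := p.1, res := o, dir := p.2, tmp := [] })
        (cfg .run {} { S with
          ctl := tape n t i j ++ L, done := D', cur := z₁, res := o, dir := [], tmp := [] }) := by
      cases hb : j.testBit i with
      | true =>
        have := reach_walk (t i) M p.2 p.1 hp2 hM hp1
          { S with ctl := tape n t i j ++ L, done := D', res := o }
        rw [hz₁, hb, if_pos rfl]
        rw [hb] at hD'
        exact Reach.cons (by simp [hD']) this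
      | false =>
        have := reach_clearDir p.2
          { S with ctl := tape n t i j ++ L, done := D', cur := p.1, res := o, tmp := [] }
        rw [hz₁, hb, if_neg (by simp)]
        rw [hb] at hD'
        refine (Reach.cons (by simp [hD']) this).mono ?_
        rw [hp2]
        have : t i * 4 ≤ t i * (2 * M + 3) := Nat.mul_le_mul_left _ (by omega)
        omega
    refine (s1.trans <| s2.trans s3).mono ?_
    rw [runTime]
    have : t i * (2 * M + 7) = 4 * t i + t i * (2 * M + 3) := by ring
    omega

/-! ### Rewinding the control stack -/

theorem reach_rewind_pull (a : ℕ) (f : Bool) (L D : List Instr) (S : Mem) :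
    Reach a (cfg .rewind { flag := f } { S with done := List.replicate a .pull ++ D, ctl := L })
      (cfg .rewind { flag := f } { S with done := D, ctl := List.replicate a .pull ++ L }) := by
  induction a generalizing L with
  | zero => exact Reach.refl _
  | succ a ih =>
    exact Reach.cons (by simp [List.replicate_succ])
      (replicate_append_cons a Instr.pull L ▸ ih (.pull :: L))

theorem reach_rewind_emit (a : ℕ) (f : Bool) (L D : List Instr) (S : Mem) :
    Reach a (cfg .rewind { flag := f } { S with done := List.replicate a .emit ++ D, ctl := L })
      (cfg .rewind { flag := f } { S with done := D, ctl := List.replicate a .emit ++ L }) := by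
  induction a generalizing L with
  | zero => exact Reach.refl _
  | succ a ih =>
    exact Reach.cons (by simp [List.replicate_succ])
      (replicate_append_cons a Instr.emit L ▸ ih (.emit :: L))

theorem reach_rewind_seed (x : List Bool) (f : Bool) (L D : List Instr) (S : Mem) :
    Reach x.length (cfg .rewind { flag := f } { S with done := x.map .seed ++ D, ctl := L })
      (cfg .rewind { flag := f } { S with done := D, ctl := (x.map .seed).reverse ++ L }) := by
  induction x generalizing L with
  | nil => exact Reach.refl _
  | cons b x ih =>
    exact Reach.cons (by simp)
      (reverse_append_cons (x.map Instr.seed) (Instr.seed b) L ▸ ih (.seed b :: L))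

theorem testBit_succ_eq (j i : ℕ) :
    (j + 1).testBit i = (j.testBit i ^^ decide (2 ^ i ∣ j + 1)) := by
  rw [Nat.testBit_eq_decide_div_mod_eq, Nat.testBit_eq_decide_div_mod_eq, Nat.succ_div]
  by_cases h : 2 ^ i ∣ j + 1
  · simp only [h, if_true, decide_true, Bool.xor_true, ← decide_not, decide_eq_decide]
    omega
  · simp [h]

theorem two_pow_succ_dvd_iff (j i : ℕ) :
    2 ^ (i + 1) ∣ j + 1 ↔ j.testBit i = true ∧ 2 ^ i ∣ j + 1 := by
  constructor
  · intro h
    have h1 : 2 ^ i ∣ j + 1 := (pow_dvd_pow 2 (by omega)).trans h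
    refine ⟨?_, h1⟩
    obtain ⟨m, hm⟩ := h
    have h3 : (j + 1).testBit i = false := by
      rw [hm, Nat.testBit_two_pow_mul]
      simp
    rw [testBit_succ_eq] at h3
    simpa [h1] using h3
  · rintro ⟨hb, m, hm⟩
    have h3 : (j + 1).testBit i = false := by rw [testBit_succ_eq]; simp [hb, hm]
    rw [hm, Nat.testBit_two_pow_mul] at h3
    have : m % 2 = 0 := by
      have : m.testBit 0 = false := by simpa using h3
      rw [Nat.testBit_zero] at this
      simpa using this
    obtain ⟨m', rfl⟩ := Nat.dvd_of_mod_eq_zero this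
    exact ⟨m', by rw [hm, pow_succ]; ring⟩

/-- The stack `done` presents the lowest level first, the order in which a binary counter is
incremented. The flag is the carry, which reaches level `i` exactly when `2 ^ i ∣ j + 1`. -/
theorem reach_rewind_tape (n : ℕ) (t : ℕ → ℕ) (i j : ℕ) (L D : List Instr) (S : Mem) :
    Reach (tape n t i j).length
      (cfg .rewind { flag := true } { S with done := (tape n t i j).reverse ++ D, ctl := L })
      (cfg .rewind { flag := decide (2 ^ i ∣ j + 1) } { S with
        done := D, ctl := tape n t i (j + 1) ++ L }) := by
  induction i generalizing D L with
  | zero => simpa [tape] using reach_rewind_emit n true L D S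
  | succ i ih =>
    have e1 : (tape n t (i + 1) j).reverse ++ D = (tape n t i j).reverse ++
        .level (j.testBit i) :: (List.replicate (4 * t i) .pull ++ D) := by
      simp [tape]
    have e2 : tape n t (i + 1) (j + 1) ++ L = List.replicate (4 * t i) .pull ++
        .level ((j + 1).testBit i) :: (tape n t i (j + 1) ++ L) := by
      simp [tape]
    rw [e1, e2]
    have s1 := ih L (.level (j.testBit i) :: (List.replicate (4 * t i) .pull ++ D))
    have s3 := reach_rewind_pull (4 * t i) (decide (2 ^ (i + 1) ∣ j + 1))
      (.level ((j + 1).testBit i) :: (tape n t i (j + 1) ++ L)) D S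
    refine (s1.trans (Reach.cons ?_ s3)).mono (by simp [tape]; omega)
    simp [testBit_succ_eq, two_pow_succ_dvd_iff]

theorem tape_length (n : ℕ) (t : ℕ → ℕ) (i j j' : ℕ) :
    (tape n t i j).length = (tape n t i j').length := by
  induction i with
  | zero => rfl
  | succ i ih => simp [tape, ih]

/-! ### The main loop -/

theorem reach_block (n : ℕ) (t : ℕ → ℕ) (M : ℕ) (hM : 2 ≤ M) (r j : ℕ) (x o : List Bool)
    (hx : x.length ≤ M) (cnt : List Mark) (a : Mark) :
    Reach (runTime n t M r + (tape n t r 0).length + 3 * M + 4)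
      (cfg .next {} {
        cnt := a :: cnt, ctl := (x.map .seed).reverse ++ tape n t r j, res := o })
      (cfg .next {} {
        cnt := cnt, ctl := (x.map .seed).reverse ++ tape n t r (j + 1),
        res := (block n t r j x).reverse ++ o }) := by
  have s0 : Reach 1 (cfg .next {} {
        cnt := a :: cnt, ctl := (x.map .seed).reverse ++ tape n t r j, res := o })
      (cfg .run {} { cnt := cnt, ctl := (x.map .seed).reverse ++ tape n t r j, res := o }) :=
    Reach.single (by simp)
  have s1 := reach_run_seed x.reverse (tape n t r j) [] [] { cnt := cnt, res := o }
  obtain ⟨z', hz', s2⟩ := reach_run_tape n t M hM r j [] (x.map .seed) x o hx { cnt := cnt }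
  have s3 : Reach 1 (cfg .run {} {
        ctl := [], done := (tape n t r j).reverse ++ x.map .seed, cur := z',
        res := (block n t r j x).reverse ++ o, cnt := cnt })
      (cfg .rewind { flag := true } {
        ctl := [], done := (tape n t r j).reverse ++ x.map .seed, cur := z',
        res := (block n t r j x).reverse ++ o, cnt := cnt }) := Reach.single (by simp)
  have s4 := reach_rewind_tape n t r j [] (x.map .seed)
    { cur := z', res := (block n t r j x).reverse ++ o, cnt := cnt }
  have s5 := reach_rewind_seed x (decide (2 ^ r ∣ j + 1)) (tape n t r (j + 1)) []
    { cur := z', res := (block n t r j x).reverse ++ o, cnt := cnt }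
  have s6 : Reach 1 (cfg .rewind { flag := decide (2 ^ r ∣ j + 1) } {
        ctl := (x.map .seed).reverse ++ tape n t r (j + 1), cur := z',
        res := (block n t r j x).reverse ++ o, cnt := cnt })
      (cfg .clearCur {} {
        ctl := (x.map .seed).reverse ++ tape n t r (j + 1), cur := z',
        res := (block n t r j x).reverse ++ o, cnt := cnt }) := Reach.single (by simp)
  have s7 := reach_clearCur z' {
        ctl := (x.map .seed).reverse ++ tape n t r (j + 1),
        res := (block n t r j x).reverse ++ o, cnt := cnt }
  simp only [List.map_reverse, List.reverse_reverse, List.append_nil, List.length_reverse] at s1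
  rw [List.append_nil] at s2 s4 s5
  refine (s0.trans <| s1.trans <| s2.trans <| s3.trans <| s4.trans <| s5.trans <|
    s6.trans s7).mono ?_
  rw [tape_length n t r j 0]
  omega

theorem reach_blocks (n : ℕ) (t : ℕ → ℕ) (M : ℕ) (hM : 2 ≤ M) (r m j : ℕ) (x o : List Bool)
    (hx : x.length ≤ M) :
    Reach (m * (runTime n t M r + (tape n t r 0).length + 3 * M + 4))
      (cfg .next {} {
        cnt := List.replicate m .keep, ctl := (x.map .seed).reverse ++ tape n t r j, res := o })
      (cfg .next {} {
        cnt := [], ctl := (x.map .seed).reverse ++ tape n t r (j + m),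
        res := (((List.range' j m).map fun i => block n t r i x).flatten).reverse ++ o }) := by
  induction m generalizing j o with
  | zero => simpa using Reach.refl _
  | succ m ih =>
    have s1 := reach_block n t M hM r j x o hx (List.replicate m .keep) .keep
    have s2 := ih (j + 1) ((block n t r j x).reverse ++ o)
    rw [Nat.succ_mul m, Nat.add_comm]
    have e : j + 1 + m = j + (m + 1) := by omega
    rw [e] at s2
    have e2 : (((List.range' j (m + 1)).map fun i => block n t r i x).flatten).reverse ++ o =
        (((List.range' (j + 1) m).map fun i => block n t r i x).flatten).reverse ++
          ((block n t r j x).reverse ++ o) := by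
      simp [List.range'_succ]
    rw [e2]
    exact s1.trans s2

/-- A bound for the running time of the machine. -/
def totalTime (n k b l s : ℕ) : ℕ :=
  n + k + b + l + 4 +
    (k + b + l + (k - 1).size * (2 * k + 3 * (b * k) + 2 * l + 5) + 2 * (b * k) + b + l + s + 4) +
  k * (runTime n (steps (k - 1) b l) (s + 2) (k - 1).size +
    (tape n (steps (k - 1) b l) (k - 1).size 0).length + 3 * (s + 2) + 4) + 1 +
  (k * n + 1) + (s + (tape n (steps (k - 1) b l) (k - 1).size 0).length + 1)

theorem reach_machine (n k : ℕ) (q : List Bool) (l : ℕ) (x : List Bool) :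
    Reach (totalTime n k q.length l x.length)
      (cfg .readN {} { inp := List.replicate n (some true) ++ none ::
        (List.replicate k (some true) ++ none :: (q.map some ++ none ::
          (List.replicate l (some true) ++ none :: x.map some))) })
      ⟨none, {}, Mem.stk { out := ((List.range k).map fun i =>
        block n (steps (k - 1) q.length l) (k - 1).size i x).flatten }⟩ := by
  have s1 := reach_setup n k q l x
  have s2 := reach_blocks n (steps (k - 1) q.length l) (x.length + 2) (by omega) (k - 1).size k 0 x
    [] (by omega)
  rw [List.append_nil, ← List.range_eq_range'] at s2
  set t := steps (k - 1) q.length l with ht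
  set B := ((List.range k).map fun i => block n t (k - 1).size i x).flatten with hB
  have hBl : B.length = k * n := by
    rw [hB, List.length_flatten, List.map_map]
    have : (List.length ∘ fun i => block n t (k - 1).size i x) = fun _ => n :=
      funext fun i => block_length _ _ _ _ _
    rw [this]; simp
  set L := (x.map Instr.seed).reverse ++ tape n t (k - 1).size (0 + k) with hL
  have s3 : Reach 1 (cfg .next {} { ctl := L, res := B.reverse })
      (cfg .write {} { ctl := L, res := B.reverse }) := Reach.single (by simp)
  have s4 := reach_write B.reverse [] { ctl := L }
  have s5 := reach_clearCtl L { out := B }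
  rw [List.append_nil, List.reverse_reverse] at s4
  refine (s1.trans <| s2.trans <| s3.trans <| s4.trans s5).mono ?_
  rw [totalTime, ← ht, List.length_reverse, hBl, hL, List.length_append, List.length_reverse,
    List.length_map, tape_length n t _ (0 + k) 0]
  omega

/-! ### Block decision trees as tests -/

/-- The block of `n` bits given by a list. -/
def toBlock (n : ℕ) (l : List Bool) : BitString n := fun i => l.getD i false

theorem toBlock_ofFn {n : ℕ} (x : BitString n) : toBlock n (List.ofFn x) = x := by
  funext i; simp [toBlock]

theorem ofFn_toBlock {n : ℕ} {l : List Bool} (h : l.length = n) : List.ofFn (toBlock n l) = l := by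
  subst h
  refine List.ext_getElem (by simp) fun i h1 h2 => ?_
  simp [toBlock, h2]

open Classical in
theorem isTest_eval {n k : ℕ} {A : Type u} (T : BlockDecisionTree n A k) (E : Set (List A)) :
    IsTest A k (fun Xs => if T.eval (Xs.map (toBlock n)) ∈ E then 1 else 0) := by
  induction T generalizing E with
  | leaf => simp only [IsTest]; split_ifs <;> norm_num
  | node f child ih =>
    refine ⟨fun X => f (toBlock n X), fun a Xs =>
      if (child a).eval (Xs.map (toBlock n)) ∈ {l | a :: l ∈ E} then 1 else 0,
      fun a => ih a _, fun X Xs => ?_⟩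
    simp [BlockDecisionTree.eval]

theorem eval_congr {n k : ℕ} {A : Type u} (h : Subsingleton A ∨ k = 0)
    (T : BlockDecisionTree n A k) (Xs Ys : List (BitString n)) (hX : Xs.length = k)
    (hY : Ys.length = k) : T.eval Xs = T.eval Ys := by
  induction T generalizing Xs Ys with
  | leaf => simp [BlockDecisionTree.eval]
  | node f child ih =>
    have hA : Subsingleton A := h.resolve_right (by omega)
    match Xs, Ys, hX, hY with
    | X :: Xs, Y :: Ys, hX, hY =>
      simp only [BlockDecisionTree.eval]
      rw [Subsingleton.elim (f X) (f Y),
        ih _ (Or.inl hA) Xs Ys (by simpa using hX) (by simpa using hY)]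

theorem map_eq_pure {α β : Type*} (p : PMF α) (f : α → β) (b : β) (h : ∀ a, f a = b) :
    p.map f = PMF.pure b := by
  have : f = Function.const α b := funext h
  rw [this, PMF.map_const]

open Classical in
theorem toReal_map_uniform {α : Type*} {β : Type*} [Fintype α] [Nonempty α] (f : α → β)
    (E : Set β) : (((PMF.uniformOfFintype α).map f).toOuterMeasure E).toReal =
      (∑ x, if f x ∈ E then (1 : ℝ) else 0) / Fintype.card α := by
  rw [PMF.toOuterMeasure_map_apply, PMF.toOuterMeasure_uniformOfFintype_apply, ENNReal.toReal_div]
  simp [Fintype.card_subtype, Set.mem_preimage]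

theorem avg_eq_sum (s : ℕ) (f : List Bool → ℝ) :
    (∑ x : BitString s, f (List.ofFn x)) / 2 ^ s = avg s f := by
  induction s generalizing f with
  | zero => simp
  | succ s ih =>
    rw [avg_succ, ← ih, ← ih, ← (Fin.consEquiv fun _ => Bool).sum_comp, Fintype.sum_prod_type]
    simp [Fin.consEquiv, pow_succ]
    ring

theorem avgBlocks_eq_sum (n k : ℕ) (F : List (List Bool) → ℝ) :
    (∑ X : Fin k → BitString n, F (List.ofFn fun i => List.ofFn (X i))) / (2 ^ n) ^ k =
      avgBlocks n k F := by
  induction k generalizing F with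
  | zero => simp [avgBlocks]
  | succ k ih =>
    rw [avgBlocks, ← avg_eq_sum, ← (Fin.consEquiv fun _ => BitString n).sum_comp,
      Fintype.sum_prod_type]
    simp only [← ih, ← Finset.sum_div, div_div, pow_succ]
    simp [Fin.consEquiv]

/-! ### The generator is pseudorandom -/

/-- The generator. -/
def gen (n k b l s : ℕ) (x : BitString s) (i : Fin k) : BitString n :=
  toBlock n (block n (steps (k - 1) b l) (k - 1).size i (List.ofFn x))

theorem ofFn_eq_map_range {α : Type*} (k : ℕ) (f : ℕ → α) :
    (List.ofFn fun i : Fin k => f i) = (List.range k).map f :=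
  List.ext_getElem (by simp) fun i h1 h2 => by simp

theorem encodeOutput_gen (n k b l s : ℕ) (x : BitString s) :
    encodeOutput (gen n k b l s x) = ((List.range k).map fun i =>
      block n (steps (k - 1) b l) (k - 1).size i (List.ofFn x)).flatten := by
  unfold encodeOutput gen
  rw [← ofFn_eq_map_range]
  simp only [ofFn_toBlock (block_length _ _ _ _ _)]

theorem le_two_pow_size_pred (k : ℕ) : k ≤ 2 ^ (k - 1).size := by
  have := Nat.lt_size_self (k - 1)
  omega

theorem sub_le_div_two_pow (h i : ℕ) (hi : i < h.size) : h.size - i ≤ h / 2 ^ i := by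
  have h1 : 2 ^ (h.size - 1) ≤ h := Nat.lt_size.mp (by omega)
  rw [Nat.le_div_iff_mul_le (by positivity)]
  have h2 : h.size - 1 - i < 2 ^ (h.size - 1 - i) := Nat.lt_two_pow_self
  calc (h.size - i) * 2 ^ i ≤ 2 ^ (h.size - 1 - i) * 2 ^ i := Nat.mul_le_mul_right _ (by omega)
    _ = 2 ^ (h.size - 1) := by rw [← pow_add]; congr 1; omega
    _ ≤ h := h1

/-- Since `(23 / 24) ^ 33 ≤ 1 / 4`, 33 steps per unit gain a factor 4; the 34th pays for the step
lost in `mixing`. The share `p * 2 ^ i` outweighs the number of states, `h` yields `(1 / 4) ^ (r -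
i)` and `l` yields `(1 / 2) ^ l`. The mixing term is then at most the current error, and tripling
stays below the factor 4 gained in passing to level `i + 1`. -/
theorem level_error (Q p h l i r : ℕ) (hQ : Q ≤ 2 ^ p) (hp : 0 < p) (hi : i < r)
    (hr : r - i ≤ h) :
    2 * ((1 / 2) ^ l * (1 / 4) ^ (r - i)) +
      (Q : ℝ) ^ 2 ^ i * (23 / 24) ^ (34 * (h + p * 2 ^ i + l) - 1) ≤
      (1 / 2) ^ l * (1 / 4) ^ (r - (i + 1)) := by
  have hp' : 0 < p * 2 ^ i := by positivity
  have h1 : (23 / 24 : ℝ) ^ (34 * (h + p * 2 ^ i + l) - 1) ≤ (1 / 4) ^ (h + p * 2 ^ i + l) := by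
    calc (23 / 24 : ℝ) ^ (34 * (h + p * 2 ^ i + l) - 1)
        ≤ (23 / 24) ^ (33 * (h + p * 2 ^ i + l)) :=
          pow_le_pow_of_le_one (by norm_num) (by norm_num) (by omega)
      _ = ((23 / 24) ^ 33) ^ (h + p * 2 ^ i + l) := by rw [pow_mul]
      _ ≤ _ := by gcongr; norm_num
  have h2 : (Q : ℝ) ^ 2 ^ i ≤ 2 ^ (p * 2 ^ i) := by
    rw [pow_mul]; gcongr; exact_mod_cast hQ
  have h3 : (Q : ℝ) ^ 2 ^ i * (23 / 24) ^ (34 * (h + p * 2 ^ i + l) - 1) ≤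
      (1 / 2) ^ l * (1 / 4) ^ (r - i) := by
    calc _ ≤ (2 : ℝ) ^ (p * 2 ^ i) * (1 / 4) ^ (h + p * 2 ^ i + l) := by gcongr
      _ = (1 / 4) ^ h * (1 / 4) ^ l * (1 / 2) ^ (p * 2 ^ i) := by
        rw [pow_add, pow_add, show (1 / 4 : ℝ) = 1 / 2 * (1 / 2) by norm_num]
        generalize p * 2 ^ i = m
        have : (2 : ℝ) ^ m * (1 / 2) ^ m = 1 := by rw [← mul_pow]; norm_num
        simp only [mul_pow]
        linear_combination ((1 / 2 : ℝ) ^ h * (1 / 2) ^ h * ((1 / 2) ^ l * (1 / 2) ^ l) *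
          (1 / 2) ^ m) * this
      _ ≤ (1 / 4) ^ (r - i) * (1 / 2) ^ l * 1 := by
        have a1 : (1 / 4 : ℝ) ^ h ≤ (1 / 4) ^ (r - i) :=
          pow_le_pow_of_le_one (by norm_num) (by norm_num) hr
        have a2 : (1 / 4 : ℝ) ^ l ≤ (1 / 2) ^ l := by gcongr; norm_num
        have a3 : (1 / 2 : ℝ) ^ (p * 2 ^ i) ≤ 1 := pow_le_one₀ (by norm_num) (by norm_num)
        gcongr
      _ = _ := by ring
  have h4 : (1 / 4 : ℝ) ^ (r - (i + 1)) = 4 * (1 / 4) ^ (r - i) := by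
    rw [show r - i = r - (i + 1) + 1 by omega, pow_succ]; ring
  have h5 : (0 : ℝ) ≤ (1 / 2) ^ l * (1 / 4) ^ (r - i) := by positivity
  rw [h4]
  nlinarith

open Classical in
theorem gen_isPRG (n k : ℕ) (A : Type u) [Fintype A] (hA : 2 ≤ Fintype.card A) (l : ℕ) :
    IsBlockDecisionTreePRG A ((1 / 2) ^ l) (gen n k (Fintype.card A).size l
      (seedLength n (steps (k - 1) (Fintype.card A).size l) (k - 1).size)) := by
  intro T E
  set Q := Fintype.card A with hQ
  set r := (k - 1).size with hr
  have hne : Nonempty A := Fintype.card_pos_iff.mp (by omega)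
  have hb : 0 < Q.size := Nat.size_pos.mpr (by omega)
  -- `generator_error` counts `t i + 1` walk steps for the bound `(23 / 24) ^ t i`.
  obtain ⟨t, ht⟩ : ∃ t : ℕ → ℕ, steps (k - 1) Q.size l = fun i => t i + 1 := by
    refine ⟨fun i => steps (k - 1) Q.size l i - 1, funext fun i => ?_⟩
    have : 0 < Q.size * 2 ^ i := by positivity
    have h0 := Nat.zero_le ((k - 1) / 2 ^ i)
    simp only [steps]; omega
  set F : List (List Bool) → ℝ := fun Xs => if T.eval (Xs.map (toBlock n)) ∈ E then 1 else 0
  have hF : IsTest A k F := isTest_eval T E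
  have hkr : 2 ^ r - k + k = 2 ^ r := Nat.sub_add_cancel (le_two_pow_size_pred k)
  have hF' : IsTest A (2 ^ r) (fun Xs => F (Xs.take k)) := by
    rw [← hkr]; exact hF.take _ k
  have key := generator_error n t (fun i => (1 / 2) ^ l * (1 / 4) ^ (r - i)) r (by positivity)
    (fun i hi => by
      have := level_error Q Q.size ((k - 1) / 2 ^ i) l i r (Nat.lt_size_self Q).le hb hi
        (sub_le_div_two_pow _ _ hi)
      have e : t i = 34 * ((k - 1) / 2 ^ i + Q.size * 2 ^ i + l) - 1 := by
        have := congrFun ht i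
        simp only [steps] at this; omega
      rw [e]; exact this) r le_rfl _ hF'
  have hs : avgBlocks n (2 ^ r) (fun Xs => F (Xs.take k)) = avgBlocks n k F := by
    rw [← hkr]; exact avgBlocks_take n _ k F
  rw [hs, ← ht] at key
  rw [toReal_map_uniform, toReal_map_uniform]
  have e1 : (∑ x : BitString (seedLength n (steps (k - 1) Q.size l) r),
      if T.eval (List.ofFn (gen n k Q.size l _ x)) ∈ E then (1 : ℝ) else 0) /
        Fintype.card (BitString (seedLength n (steps (k - 1) Q.size l) r)) =
      avg (seedLength n (steps (k - 1) Q.size l) r)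
        (fun z => F ((blocks n (steps (k - 1) Q.size l) r z).take k)) := by
    rw [← avg_eq_sum]
    congr 1
    · refine Finset.sum_congr rfl fun x _ => ?_
      have : List.ofFn (gen n k Q.size l _ x) =
          ((blocks n (steps (k - 1) Q.size l) r (List.ofFn x)).take k).map (toBlock n) := by
        rw [blocks_eq_map, ← List.map_take, List.take_range, min_eq_left (le_two_pow_size_pred k),
          List.map_map, ← ofFn_eq_map_range]
        rfl
      simp only [F, this]
    · simp
  have e2 : (∑ X : Fin k → BitString n, if T.eval (List.ofFn X) ∈ E then (1 : ℝ) else 0) /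
      Fintype.card (Fin k → BitString n) = avgBlocks n k F := by
    rw [← avgBlocks_eq_sum]
    congr 1
    · refine Finset.sum_congr rfl fun X _ => ?_
      simp only [F, List.map_ofFn, Function.comp_def, toBlock_ofFn]
    · simp
  rw [e1, e2]
  simpa using key

theorem isPRG_of_trivial {n k s : ℕ} (A : Type u) (h : Subsingleton A ∨ k = 0) {γ : ℝ}
    (hγ : 0 ≤ γ) (G : BitString s → Fin k → BitString n) : IsBlockDecisionTreePRG A γ G := by
  intro T E
  set b := T.eval (List.ofFn fun _ : Fin k => fun _ : Fin n => false)
  rw [map_eq_pure _ _ b fun x => eval_congr h T _ _ (by simp) (by simp),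
    map_eq_pure _ _ b fun x => eval_congr h T _ _ (by simp) (by simp)]
  simpa using hγ

theorem isBlockDecisionTreePRG_mono {n k s : ℕ} {A : Type u} {γ γ' : ℝ}
    {G : BitString s → Fin k → BitString n} (h : IsBlockDecisionTreePRG A γ G) (hγ : γ ≤ γ') :
    IsBlockDecisionTreePRG A γ' G := fun T E => (h T E).trans hγ

theorem half_pow_ceil_le {γ : ℝ} (hγ : 0 < γ) :
    (1 / 2 : ℝ) ^ ⌈Real.logb 2 (1 / γ)⌉₊ ≤ γ := by
  have h1 : Real.logb 2 (1 / γ) ≤ ⌈Real.logb 2 (1 / γ)⌉₊ := Nat.le_ceil _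
  rw [Real.logb_le_iff_le_rpow (by norm_num) (by positivity), Real.rpow_natCast] at h1
  rw [one_div (2 : ℝ), inv_pow]
  exact inv_le_of_inv_le₀ hγ ((one_div γ).symm.le.trans h1)

/-! ### The seed length -/

theorem two_pow_size_le (h : ℕ) (hh : 0 < h) : 2 ^ h.size ≤ 2 * h := by
  have h1 : 2 ^ (h.size - 1) ≤ h := Nat.lt_size.mp (Nat.sub_lt (Nat.size_pos.mpr hh) one_pos)
  have h2 : 2 ^ h.size = 2 * 2 ^ (h.size - 1) := by
    rw [← pow_succ', Nat.sub_add_cancel (Nat.size_pos.mpr hh)]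
  omega

theorem seedLength_le (n h b l : ℕ) :
    seedLength n (steps h b l) h.size ≤ n + 2 + 136 * (2 * h + 2 * (b * h) + h.size * l) := by
  unfold seedLength steps
  have e : ∑ i ∈ Finset.range h.size, 4 * (34 * (h / 2 ^ i + b * 2 ^ i + l)) =
      136 * (∑ i ∈ Finset.range h.size, h / 2 ^ i + b * ∑ i ∈ Finset.range h.size, 2 ^ i +
        h.size * l) := by
    have hl : h.size * l = ∑ _i ∈ Finset.range h.size, l := by simp
    rw [Finset.mul_sum, hl, ← Finset.sum_add_distrib, ← Finset.sum_add_distrib, Finset.mul_sum]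
    exact Finset.sum_congr rfl fun i _ => by ring
  rw [e]
  have h1 : ∑ i ∈ Finset.range h.size, h / 2 ^ i ≤ h * 2 / (2 - 1) := Nat.geom_sum_le le_rfl h _
  have h2 : ∑ i ∈ Finset.range h.size, 2 ^ i ≤ 2 * h := by
    rcases Nat.eq_zero_or_pos h with rfl | hh
    · simp
    · have := two_pow_size_le h hh
      have h3 := Nat.geomSum_eq (le_refl 2) h.size
      simp only [Nat.reduceSub, Nat.div_one] at h3
      omega
  have h4 : b * ∑ i ∈ Finset.range h.size, 2 ^ i ≤ b * (2 * h) := Nat.mul_le_mul_left _ h2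
  have h5 : b * (2 * h) = 2 * (b * h) := by ring
  omega

theorem size_le_two_logb (q : ℕ) (hq : 2 ≤ q) : (q.size : ℝ) ≤ 2 * Real.logb 2 q := by
  have h1 : 2 ^ (q.size - 1) ≤ q := Nat.lt_size.mp (Nat.sub_lt (Nat.size_pos.mpr (by omega)) one_pos)
  have hq' : (0 : ℝ) < q := by positivity
  have h2 : ((q.size - 1 : ℕ) : ℝ) ≤ Real.logb 2 q := by
    rw [Real.le_logb_iff_rpow_le (by norm_num) hq', Real.rpow_natCast]
    exact_mod_cast h1
  have h3 : (1 : ℝ) ≤ Real.logb 2 q := by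
    rw [Real.le_logb_iff_rpow_le (by norm_num) hq', Real.rpow_one]
    exact_mod_cast hq
  have h4 : (q.size : ℝ) ≤ ((q.size - 1 : ℕ) : ℝ) + 1 := by
    have : q.size ≤ q.size - 1 + 1 := by omega
    exact_mod_cast this
  linarith

/-- The two extra seed bits and the rounding are absorbed by `k * logb 2 q`, using `1 ≤ logb 2 q`
and `logb 2 k ≤ k`; its coefficient adds up to `2 + 272 + 544 + 272 = 1090`. -/
theorem seedLength_real_le (n k q : ℕ) (hq : 2 ≤ q) (hk : 0 < k) (g : ℝ) :
    (seedLength n (steps (k - 1) q.size ⌈g⌉₊) (k - 1).size : ℝ) ≤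
      n + 1100 * (k * Real.logb 2 q + Real.logb 2 k * max 0 g) := by
  have h0 : (seedLength n (steps (k - 1) q.size ⌈g⌉₊) (k - 1).size : ℝ) ≤
      n + 2 + 136 * (2 * (k - 1 : ℕ) + 2 * (q.size * (k - 1 : ℕ)) + (k - 1).size * ⌈g⌉₊) := by
    exact_mod_cast seedLength_le n (k - 1) q.size ⌈g⌉₊
  have hk' : (1 : ℝ) ≤ k := by exact_mod_cast hk
  have hk1 : ((k - 1 : ℕ) : ℝ) ≤ k := by exact_mod_cast Nat.sub_le k 1
  have hlq : (1 : ℝ) ≤ Real.logb 2 q := by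
    rw [Real.le_logb_iff_rpow_le (by norm_num) (by positivity), Real.rpow_one]
    exact_mod_cast hq
  have hsz := size_le_two_logb q hq
  have hlk : 0 ≤ Real.logb 2 k := Real.logb_nonneg (by norm_num) hk'
  have hlk' : Real.logb 2 k ≤ k := by
    rw [Real.logb_le_iff_le_rpow (by norm_num) (by positivity), Real.rpow_natCast]
    exact_mod_cast Nat.lt_two_pow_self.le
  have hr : ((k - 1).size : ℝ) ≤ 2 * Real.logb 2 k := by
    rcases Nat.lt_or_ge k 2 with h | h
    · obtain rfl : k = 1 := by omega
      simp
    · refine le_trans ?_ (size_le_two_logb k h)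
      exact_mod_cast Nat.size_le_size (Nat.sub_le k 1)
  have hg : (⌈g⌉₊ : ℝ) ≤ max 0 g + 1 := by
    rcases le_or_gt 0 g with h | h
    · rw [max_eq_right h]; exact (Nat.ceil_lt_add_one h).le
    · rw [Nat.ceil_eq_zero.mpr h.le]
      have := le_max_left 0 g
      push_cast; linarith
  have hM : 0 ≤ max 0 g := le_max_left 0 g
  set M := max 0 g
  have a1 : (q.size : ℝ) * (k - 1 : ℕ) ≤ 2 * Real.logb 2 q * k := by gcongr
  have a2 : ((k - 1).size : ℝ) * ⌈g⌉₊ ≤ 2 * Real.logb 2 k * (M + 1) := by gcongr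
  have a3 : (k : ℝ) ≤ k * Real.logb 2 q := le_mul_of_one_le_right (by positivity) hlq
  have a4 : 0 ≤ Real.logb 2 k * M := by positivity
  nlinarith

/-! ### The running time -/

theorem size_pred_le (k : ℕ) : (k - 1).size ≤ k := by
  rw [Nat.size_le]
  exact lt_of_le_of_lt (Nat.sub_le k 1) Nat.lt_two_pow_self

theorem steps_le (k b l S i : ℕ) (hk : k ≤ S) (hb : b ≤ S) (hl : l ≤ S) (hS : 1 ≤ S)
    (hi : i < (k - 1).size) : steps (k - 1) b l i ≤ 102 * S ^ 2 := by
  have h1 : 2 ^ i ≤ k - 1 := Nat.lt_size.mp hi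
  have h2 : (k - 1) / 2 ^ i ≤ k - 1 := Nat.div_le_self _ _
  have h3 : b * 2 ^ i ≤ S * S := Nat.mul_le_mul hb (by omega)
  have h4 : S ≤ S * S := Nat.le_mul_of_pos_left S hS
  rw [steps, pow_two]
  omega

theorem tape_length_le (n : ℕ) (t : ℕ → ℕ) (B i : ℕ) (h : ∀ l < i, t l ≤ B) :
    (tape n t i 0).length ≤ n + i * (4 * B + 1) := by
  induction i with
  | zero => simp [tape]
  | succ i ih =>
    have h1 := ih fun l hl => h l (by omega)
    have h2 := h i (by omega)
    simp only [tape, List.length_append, List.length_replicate, List.length_cons]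
    rw [Nat.succ_mul i]
    omega

theorem runTime_le (n : ℕ) (t : ℕ → ℕ) (M B i : ℕ) (h : ∀ l < i, t l ≤ B) :
    runTime n t M i ≤ n + i * (B * (2 * M + 7) + 2) := by
  induction i with
  | zero => simp [runTime]
  | succ i ih =>
    have h1 := ih fun l hl => h l (by omega)
    have h2 : t i * (2 * M + 7) ≤ B * (2 * M + 7) := Nat.mul_le_mul_right _ (h i (by omega))
    rw [runTime, Nat.succ_mul i]
    omega

/-- The main loop dominates: at most `S` runs through at most `S` levels, with `O(S ^ 2)` walk steps
per level, each scanning `O(S ^ 3)` bits. -/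
theorem totalTime_le (n k b l s S : ℕ) (hS : 1 ≤ S) (hn : n ≤ S) (hk : k ≤ S) (hb : b ≤ S)
    (hl : l ≤ S) (hs : s ≤ 820 * S ^ 3) : totalTime n k b l s ≤ 1000000 * S ^ 7 := by
  have hr : (k - 1).size ≤ S := (size_pred_le k).trans hk
  have hst := fun i hi => steps_le k b l S i hk hb hl hS hi
  have ht := tape_length_le n (steps (k - 1) b l) (102 * S ^ 2) (k - 1).size hst
  have hrun := runTime_le n (steps (k - 1) b l) (s + 2) (102 * S ^ 2) (k - 1).size hst
  have p1 : 1 ≤ S ^ 7 := Nat.one_le_pow _ _ hS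
  have p2 : S ≤ S ^ 7 := Nat.le_self_pow (by norm_num) S
  have p3 : ∀ a, a ≤ 7 → S ^ a ≤ S ^ 7 := fun a ha => Nat.pow_le_pow_right hS ha
  have q2 := p3 2 (by norm_num)
  have q3 := p3 3 (by norm_num)
  have q4 := p3 4 (by norm_num)
  have q6 := p3 6 (by norm_num)
  have hS1 : ∀ a, 1 ≤ S ^ a := fun a => Nat.one_le_pow _ _ hS
  have hSS : ∀ a b, a ≤ b → S ^ a ≤ S ^ b := fun a b h => Nat.pow_le_pow_right hS h
  have ht' : (tape n (steps (k - 1) b l) (k - 1).size 0).length ≤ 410 * S ^ 3 := by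
    have : (k - 1).size * (4 * (102 * S ^ 2) + 1) ≤ S * (409 * S ^ 2) :=
      Nat.mul_le_mul hr (by have := hS1 2; omega)
    have e : S * (409 * S ^ 2) = 409 * S ^ 3 := by ring
    have := hSS 1 3 (by norm_num)
    rw [pow_one] at this
    omega
  have hrun' : runTime n (steps (k - 1) b l) (s + 2) (k - 1).size ≤ 170000 * S ^ 6 := by
    have h1 : 102 * S ^ 2 * (2 * (s + 2) + 7) + 2 ≤ 102 * S ^ 2 * (1651 * S ^ 3) + 2 * S ^ 5 := by
      have := hS1 3
      have := hS1 5
      have : 102 * S ^ 2 * (2 * (s + 2) + 7) ≤ 102 * S ^ 2 * (1651 * S ^ 3) :=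
        Nat.mul_le_mul_left _ (by omega)
      omega
    have h2 := Nat.mul_le_mul hr h1
    have e : S * (102 * S ^ 2 * (1651 * S ^ 3) + 2 * S ^ 5) = 168404 * S ^ 6 := by ring
    have := hSS 1 6 (by norm_num)
    rw [pow_one] at this
    omega
  have hloop : k * (runTime n (steps (k - 1) b l) (s + 2) (k - 1).size +
      (tape n (steps (k - 1) b l) (k - 1).size 0).length + 3 * (s + 2) + 4) ≤ 180000 * S ^ 7 := by
    have h1 := hSS 3 6 (by norm_num)
    have h2 := hS1 6
    have h3 := Nat.mul_le_mul hk (show runTime n (steps (k - 1) b l) (s + 2) (k - 1).size +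
      (tape n (steps (k - 1) b l) (k - 1).size 0).length + 3 * (s + 2) + 4 ≤ 180000 * S ^ 6 by omega)
    have e : S * (180000 * S ^ 6) = 180000 * S ^ 7 := by ring
    omega
  have hbk : b * k ≤ S ^ 2 := by rw [pow_two]; exact Nat.mul_le_mul hb hk
  have hkn : k * n ≤ S ^ 2 := by rw [pow_two]; exact Nat.mul_le_mul hk hn
  have hlev : (k - 1).size * (2 * k + 3 * (b * k) + 2 * l + 5) ≤ 12 * S ^ 3 := by
    have h1 := hSS 1 2 (by norm_num)
    rw [pow_one] at h1
    have h2 := hS1 2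
    have := Nat.mul_le_mul hr (show 2 * k + 3 * (b * k) + 2 * l + 5 ≤ 12 * S ^ 2 by omega)
    have e : S * (12 * S ^ 2) = 12 * S ^ 3 := by ring
    omega
  rw [totalTime]
  omega

/-! ### The machine computes the generator -/

theorem initList_machine (w : List (Option Bool)) :
    Turing.initList machine.tm (w.map machine.inputAlphabet.invFun) =
      cfg .readN {} { inp := w } := by
  have : w.map machine.inputAlphabet.invFun = w := List.map_id w
  rw [this]
  unfold Turing.initList cfg
  congr 1
  funext k
  cases k <;> rfl

theorem haltList_machine (w : List Bool) :
    Turing.haltList machine.tm (w.map machine.outputAlphabet.invFun) =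
      ⟨none, {}, Mem.stk { out := w }⟩ := by
  have : w.map machine.outputAlphabet.invFun = w := List.map_id w
  rw [this]
  unfold Turing.haltList
  congr 1
  funext k
  cases k <;> rfl

theorem outputsWithin_of_reach {w : List (Option Bool)} {w' : List Bool} {t : ℕ}
    (h : Reach t (cfg .readN {} { inp := w }) ⟨none, {}, Mem.stk { out := w' }⟩) :
    OutputsWithin machine w w' t := by
  obtain ⟨j, hj, e⟩ := h
  refine ⟨⟨⟨j, ?_⟩, hj⟩⟩
  rw [initList_machine, Option.map_some, haltList_machine]
  exact e

theorem machine_outputs (n k q l s : ℕ) (x : BitString s) :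
    OutputsWithin machine (encodeInput n k q l x) (encodeOutput (gen n k q.size l s x))
      (totalTime n k q.size l s) := by
  refine outputsWithin_of_reach ?_
  have := reach_machine n k q.bits l (List.ofFn x)
  rw [Nat.size_eq_bits_len, List.length_ofFn] at this
  rw [encodeOutput_gen]
  exact this

theorem outputsWithin_mono {Γ₀ Γ₁ : Type} {M : Turing.TM2ComputableAux Γ₀ Γ₁} {w : List Γ₀}
    {w' : List Γ₁} {t t' : ℕ} (h : OutputsWithin M w w' t) (ht : t ≤ t') :
    OutputsWithin M w w' t' := by
  obtain ⟨h⟩ := h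
  exact ⟨⟨h.toEvalsTo, h.steps_le_m.trans ht⟩⟩

theorem totalTime_le_poly (n k q l s : ℕ) (c : ℕ) (hc : c = 1000000)
    (hs : s ≤ seedLength n (steps (k - 1) q.size l) (k - 1).size) :
    totalTime n k q.size l s ≤ c * (n + k + Nat.clog 2 q + l + 1) ^ c := by
  set S := n + k + Nat.clog 2 q + l + 1 with hS
  have hb : q.size ≤ Nat.clog 2 q + 1 := by
    rw [Nat.size_le, pow_succ]
    have := Nat.le_pow_clog one_lt_two q
    have : 0 < 2 ^ Nat.clog 2 q := by positivity
    omega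
  have h1 : s ≤ 820 * S ^ 3 := by
    refine hs.trans ((seedLength_le _ _ _ _).trans ?_)
    have a1 : q.size * (k - 1) ≤ S * S := Nat.mul_le_mul (by omega) (by omega)
    have a2 : (k - 1).size * l ≤ S * S :=
      Nat.mul_le_mul ((size_pred_le k).trans (by omega)) (by omega)
    have a3 : S * S ≤ S ^ 3 := by
      rw [← pow_two]; exact Nat.pow_le_pow_right (by omega) (by norm_num)
    have a4 : S ≤ S ^ 3 := Nat.le_self_pow (by norm_num) S
    omega
  refine (totalTime_le n k q.size l s S (by omega) (by omega) (by omega) (by omega) (by omega)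
    h1).trans ?_
  have : S ^ 7 ≤ S ^ c := Nat.pow_le_pow_right (by omega) (by omega)
  rw [← hc]
  exact Nat.mul_le_mul_left _ this

end INW

theorem mainTheorem2 :
    ∃ (C : ℝ) (c : ℕ) (M : Turing.TM2ComputableAux (Option Bool) Bool),
      ∀ (n k : ℕ) (A : Type u) [Fintype A] (γ : ℝ), 0 < γ →
        ∃ (s : ℕ) (Gen : BitString s → Fin k → BitString n),
          IsBlockDecisionTreePRG A γ Gen ∧
          (s : ℝ) ≤ n + C * (k * Real.logb 2 (Fintype.card A)
            + Real.logb 2 k * max 0 (Real.logb 2 (1 / γ))) ∧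
          ∀ x : BitString s,
            OutputsWithin M
              (encodeInput n k (Fintype.card A) ⌈Real.logb 2 (1 / γ)⌉₊ x)
              (encodeOutput (Gen x))
              (c * (n + k + Nat.clog 2 (Fintype.card A) + ⌈Real.logb 2 (1 / γ)⌉₊ + 1) ^ c) := by
  -- One number serves as coefficient and as exponent; it stays abstract so that the power is never
  -- expanded.
  obtain ⟨c, hc⟩ : ∃ c : ℕ, c = 1000000 := ⟨_, rfl⟩
  refine ⟨1100, c, INW.machine, fun n k A _ γ hγ => ?_⟩
  by_cases h : 2 ≤ Fintype.card A ∧ 0 < k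
  · exact ⟨_, _, INW.isBlockDecisionTreePRG_mono
      (INW.gen_isPRG n k A h.1 ⌈Real.logb 2 (1 / γ)⌉₊) (INW.half_pow_ceil_le hγ),
      INW.seedLength_real_le n k _ h.1 h.2 _,
      fun x => INW.outputsWithin_mono (INW.machine_outputs n k _ _ _ x)
        (INW.totalTime_le_poly n k _ _ _ c hc le_rfl)⟩
  -- Here the tree has a constant outcome, so an empty seed will do. The same machine still computes
  -- `gen`, because missing seed bits are read as zeros.
  · refine ⟨0, INW.gen n k (Fintype.card A).size ⌈Real.logb 2 (1 / γ)⌉₊ 0,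
      INW.isPRG_of_trivial A ?_ hγ.le _, ?_,
      fun x => INW.outputsWithin_mono (INW.machine_outputs n k _ _ _ x)
        (INW.totalTime_le_poly n k _ _ _ c hc (Nat.zero_le _))⟩
    · rcases Nat.eq_zero_or_pos k with hk | hk
      · exact Or.inr hk
      · exact Or.inl (Fintype.card_le_one_iff_subsingleton.mp (by
          by_contra hA; exact h ⟨by omega, hk⟩))
    · have hlog : ∀ m : ℕ, 0 ≤ Real.logb 2 (m : ℝ) := fun m => by
        rcases Nat.eq_zero_or_pos m with rfl | hm
        · simp
        · exact Real.logb_nonneg (by norm_num) (by exact_mod_cast hm)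
      have h1 := hlog (Fintype.card A)
      have h2 := hlog k
      have h3 : (0 : ℝ) ≤ max 0 (Real.logb 2 (1 / γ)) := le_max_left _ _
      push_cast
      positivity
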